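/- Consider the $n^2-1$ puzzle on the board $(\mathbb{Z}/n\mathbb{Z})^2$: at each step the empty square stays where it is, or is exchanged with its right, left, upper or lower neighbor, each with probability $\frac15$. For $d \ge 0$ let $\mathscr{X}_d$ be the set of possible positions of the empty square and of $d$ labeled pieces (on $d+1$ distinct squares), and let $P_d$ be the Markov chain on $\mathscr{X}_d$ obtained from the puzzle by forgetting all other pieces. A coupling of $P_d$ is a Markov process on $\mathscr{X}_d\times\mathscr{X}_d$ with a transition law $Q$ such that, for every $(x,y)$, the two marginals of $Q((x,y),\cdot)$ are $P_d(x,\cdot)$ and $P_d(y,\cdot)$; it is coalescing if the two copies stay together once they coincide. Theorem. For each fixed $d$ there is a constant $C = C(d)$ such that for all sufficiently large $n$ there is a coalescing coupling $(X_t,Y_t)_{t\ge0}$ of the chain $(\mathscr{X}_d,P_d)$ with the following property: for every $x\in\mathscr{X}_d$, if $X_0=x$ and $Y_0$ is distributed according to the stationary distribution of $P_d$, then $$\mathbf{E}\bigl[\min\{t\ge0 : X_t=Y_t\}\bigr]\le C\,n^4\log n .$$ -/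

import Mathlib

open MeasureTheory ProbabilityTheory Filter
open scoped ENNReal

/-! ### The puzzle, seen through a set of labeled pieces -/

/-- The `n × n` board with periodic boundary conditions. -/
abbrev Board (n : ℕ) : Type := ZMod n × ZMod n

/-- Positions of the empty square (the value at `none`) and of pieces with labels in `ι` (the value
at `some i`); distinct objects occupy distinct squares. With `ι = Fin d` this records the empty
square and `d` labeled pieces; with `n ^ 2 - 1` labels it is a position of the full puzzle. -/
def Config (n : ℕ) (ι : Type) : Type := Option ι ↪ Board n

namespace Config

variable {n : ℕ} {ι κ : Type}

instance : FunLike (Config n ι) (Option ι) (Board n) :=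
  inferInstanceAs (FunLike (Option ι ↪ Board n) (Option ι) (Board n))

instance : MeasurableSpace (Config n ι) := ⊤

instance : DiscreteMeasurableSpace (Config n ι) := ⟨fun _ => trivial⟩

instance [Finite ι] : Countable (Config n ι) := by
  have : Countable (ZMod n) := by
    cases n with
    | zero => exact inferInstanceAs (Countable ℤ)
    | succ k => infer_instance
  exact Function.Injective.countable
    (f := fun (s : Config n ι) => (s : Option ι → Board n)) DFunLike.coe_injective

/-- The empty square moves by `v`: it is exchanged with whatever occupies the square at
displacement `v` from it, so a labeled piece standing there is shifted into the empty square and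
all the other labeled pieces stay. -/
def move (v : Board n) (s : Config n ι) : Config n ι :=
  Function.Embedding.trans s (Equiv.swap (s none) (s none + v)).toEmbedding

/-- The five moves of the empty square: stay, right, left, up, down. -/
def dir (n : ℕ) : Fin 5 → Board n := ![(0, 0), (1, 0), (-1, 0), (0, 1), (0, -1)]

/-- One step of the chain: the empty square stays, or moves to one of its four neighbors, each with
probability `1 / 5`. -/
noncomputable def step (s : Config n ι) : PMF (Config n ι) :=
  (PMF.uniformOfFintype (Fin 5)).map fun k => move (dir n k) s

/-- Forget all the labeled pieces except those selected by `f`. -/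
def forget (f : ι ↪ κ) (s : Config n κ) : Config n ι :=
  Function.Embedding.trans f.optionMap s

/-- Forgetting pieces carries the chain with more labels (for example the full puzzle) to the chain
on the remaining labels. -/
theorem map_forget_step (f : ι ↪ κ) (s : Config n κ) :
    (step s).map (forget f) = step (forget f s) := by
  unfold step
  rw [PMF.map_comp]
  rfl

end Config

/-! ### Markov chains on a countable state space and their couplings -/

section Chains

variable {S : Type}

/-- `π` is a stationary distribution of the transition law `P`. -/
def IsStationaryDist (P : S → PMF S) (π : PMF S) : Prop := π.bind P = π

/-- A (Markovian) coupling of the Markov process with transition law `P`: a transition law on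
`S × S` whose marginals are separately `P`. -/
def IsMarkovCoupling (P : S → PMF S) (Q : S × S → PMF (S × S)) : Prop :=
  ∀ z : S × S, (Q z).map Prod.fst = P z.1 ∧ (Q z).map Prod.snd = P z.2

/-- Once the two copies coincide they stay together. -/
def Coalesces (Q : S × S → PMF (S × S)) : Prop :=
  ∀ x : S, ∀ w ∈ (Q (x, x)).support, w.1 = w.2

/-- The transition law `K` as a kernel that reads a trajectory up to time `t` and uses only its
last point. -/
noncomputable def stepKernel [MeasurableSpace S] [DiscreteMeasurableSpace S]
    (K : S → PMF S) (t : ℕ) : Kernel ((i : Finset.Iic t) → S) S where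
  toFun h := (K (h ⟨t, Finset.mem_Iic.2 le_rfl⟩)).toMeasure
  measurable' := (Measurable.of_discrete (f := fun a : S => (K a).toMeasure)).comp
    (measurable_pi_apply _)

instance [MeasurableSpace S] [DiscreteMeasurableSpace S] (K : S → PMF S) (t : ℕ) :
    IsMarkovKernel (stepKernel K t) :=
  ⟨fun h => inferInstanceAs
    (IsProbabilityMeasure (K (h ⟨t, Finset.mem_Iic.2 le_rfl⟩)).toMeasure)⟩

/-- The law, on the space of trajectories, of the time-homogeneous Markov chain with initial
distribution `ν` and transition law `K`. -/
noncomputable def chainLaw [MeasurableSpace S] [DiscreteMeasurableSpace S]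
    (ν : PMF S) (K : S → PMF S) : Measure (ℕ → S) :=
  Kernel.trajMeasure (X := fun _ => S) ν.toMeasure (stepKernel K)

/-- The first time at which the two coordinates of a trajectory in `S × S` coincide
(`∞` if they never do). -/
noncomputable def meetingTime (ω : ℕ → S × S) : ℝ≥0∞ :=
  ⨅ (t : ℕ) (_ : (ω t).1 = (ω t).2), (t : ℝ≥0∞)

/-- The expected meeting time, under the coupling `Q`, of a copy started at `x` and a copy whose
initial state has distribution `π`. -/
noncomputable def expectedMeetingTime [Countable S] [MeasurableSpace S] [DiscreteMeasurableSpace S]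
    (Q : S × S → PMF (S × S)) (x : S) (π : PMF S) : ℝ≥0∞ :=
  ∫⁻ ω, meetingTime ω ∂(chainLaw (π.map fun y => (x, y)) Q)

end Chains

/-!
Each step of the coupling makes either identical moves or independent moves in the two copies. Let
`W` be the least expected meeting time that can be reached by switching between these two options;
it solves `W = 1 + min (P_id W) (P_ind W)` off the diagonal, and the coupling that takes the better
option at every pair of positions is Markovian, coalescing, and has expected meeting time at most
`W` (`exists_expected_hitting`, `expectedMeetingTime_le`). So it is enough to bound subsolutions of
that equation, and there any strategy may be used, whatever it remembers of the past
(`le_of_subsolution`). The bound obtained is uniform over all pairs of starting positions.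

The strategy is as follows. Independent moves bring the two empty squares together. Then the pieces
are matched one after the other. Under identical moves the pieces matched so far stay matched, and
the empty square together with the two copies of the next piece evolves like the puzzle with two
labeled pieces. When these three occupy squares of a common `2 × 2` block, a bounded number of
moves in one copy, waiting in the other, turns the first copy of the piece into the position of the
second one by a 3-cycle, and the third square of this 3-cycle can be chosen to hold no matched piece
(`exists_run_match`). Independent moves follow these instructions with a probability bounded below
(`le_of_independent_run`); if they do not, everything starts afresh. The number of attempts has
bounded expectation.

The heart of the matter is that the empty square and two pieces reach a prescribed relative position
in expected time `O(n ^ 4 log n)` (`exists_expected_hitting_cornerState`). There are at most `n ^ 4`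
relative positions, the moves permute them, and hence a subsolution `h` of `h = 1 + P h` has
Dirichlet energy at most a constant times `∑ h ≤ n ^ 4 max h` (`energy_le_of_subsolution`). On the
other hand, when the empty square is next to the second piece it can push this piece around, using
boundedly many moves for each step of the piece. This embeds a two-dimensional grid into the graph
of relative positions (`gridEnergyLE_besideState`), so the square of `h` at such a position is at
most a constant times `log n` times the energy (`GridEnergyLE.corner`). From any other position the
empty square finds the second piece in time `O(n ^ 4)`. So, up to this additive term, `(max h) ^ 2`
is at most of order `n ^ 4 log n * max h`.
-/

/-! ### Trajectories and meeting times -/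

section Trajectories

variable {S : Type} [MeasurableSpace S] [DiscreteMeasurableSpace S]

instance (ν : PMF S) (K : S → PMF S) : IsProbabilityMeasure (chainLaw ν K) :=
  inferInstanceAs (IsProbabilityMeasure
    (Kernel.trajMeasure (X := fun _ => S) ν.toMeasure (stepKernel K)))

theorem lintegral_chainLaw_zero (ν : PMF S) (K : S → PMF S) (V : S → ℝ≥0∞) :
    ∫⁻ ω, V (ω 0) ∂(chainLaw ν K) = ∫⁻ z, V z ∂ν.toMeasure := by
  have h : (chainLaw ν K).map (Preorder.frestrictLe 0) =
      ν.toMeasure.map (MeasurableEquiv.piUnique (fun _ : Finset.Iic 0 => S)).symm := by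
    unfold chainLaw Kernel.trajMeasure
    rw [Measure.map_comp _ _ (by fun_prop), Kernel.traj_map_frestrictLe,
      Kernel.partialTraj_self, Measure.id_comp]
  have hg : Measurable fun x : Finset.Iic 0 → S => V (x ⟨0, Finset.mem_Iic.2 le_rfl⟩) :=
    (Measurable.of_discrete (f := V)).comp (measurable_pi_apply _)
  have h1 := lintegral_map (μ := chainLaw ν K) hg
    (g := Preorder.frestrictLe (π := fun _ : ℕ => S) 0) (by fun_prop)
  rw [h, lintegral_map hg (by fun_prop)] at h1
  exact h1.symm

theorem lintegral_chainLaw_succ (ν : PMF S) (K : S → PMF S) (V : S → ℝ≥0∞) (t : ℕ) :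
    ∫⁻ ω, V (ω (t + 1)) ∂(chainLaw ν K) =
      ∫⁻ ω, (∫⁻ w, V w ∂(K (ω t)).toMeasure) ∂(chainLaw ν K) := by
  have hV : Measurable V := Measurable.of_discrete
  have hW : Measurable fun z : S => ∫⁻ w, V w ∂(K z).toMeasure := Measurable.of_discrete
  have h := Kernel.map_frestrictLe_trajMeasure_compProd_eq_map_trajMeasure
    (X := fun _ => S) (κ := stepKernel K) (μ₀ := ν.toMeasure) (a := t)
  have hg : Measurable fun p : (Finset.Iic t → S) × S => V p.2 := hV.comp measurable_snd
  have h1 : ∫⁻ p, V p.2 ∂((chainLaw ν K).map (Preorder.frestrictLe t) ⊗ₘ stepKernel K t) =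
      ∫⁻ p, V p.2 ∂((chainLaw ν K).map fun x => (Preorder.frestrictLe t x, x (t + 1))) :=
    congrArg (fun m => ∫⁻ p : (Finset.Iic t → S) × S, V p.2 ∂m) h
  rw [Measure.lintegral_compProd hg, lintegral_map hg (by fun_prop),
    lintegral_map (hg.lintegral_kernel_prod_right') (by fun_prop)] at h1
  exact h1.symm

/-- If `V` dominates a running cost `c` plus its own expectation after one step, then it dominates
the expected total cost. -/
theorem lintegral_chainLaw_tsum_le (ν : PMF S) (K : S → PMF S) (c V : S → ℝ≥0∞)
    (h : ∀ z, c z + ∫⁻ w, V w ∂(K z).toMeasure ≤ V z) :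
    ∫⁻ ω, ∑' t : ℕ, c (ω t) ∂(chainLaw ν K) ≤ ∫⁻ z, V z ∂ν.toMeasure := by
  have hm : ∀ (g : S → ℝ≥0∞) (t : ℕ), Measurable fun ω : ℕ → S => g (ω t) := fun g t =>
    (Measurable.of_discrete (f := g)).comp (measurable_pi_apply t)
  rw [lintegral_tsum fun t => (hm c t).aemeasurable]
  refine ENNReal.tsum_le_of_sum_range_le fun T => ?_
  have key : ∀ T : ℕ, ∑ t ∈ Finset.range T, ∫⁻ ω, c (ω t) ∂(chainLaw ν K) +
      ∫⁻ ω, V (ω T) ∂(chainLaw ν K) ≤ ∫⁻ z, V z ∂ν.toMeasure := by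
    intro T
    induction T with
    | zero => simp [lintegral_chainLaw_zero]
    | succ T ih =>
      refine le_trans ?_ ih
      rw [Finset.sum_range_succ, add_assoc, lintegral_chainLaw_succ,
        ← lintegral_add_left (hm c T)]
      gcongr with ω
      exact h _
  exact le_trans le_self_add (key T)

end Trajectories

/-- The meeting time is at most the number of times at which the two copies differ. -/
theorem meetingTime_le_tsum {S : Type} [DecidableEq S] (ω : ℕ → S × S) :
    meetingTime ω ≤ ∑' t : ℕ, (if (ω t).1 = (ω t).2 then 0 else 1 : ℝ≥0∞) := by
  by_cases h : ∃ t, (ω t).1 = (ω t).2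
  · classical
    have h1 : meetingTime ω ≤ (Nat.find h : ℝ≥0∞) :=
      iInf₂_le (f := fun (t : ℕ) (_ : (ω t).1 = (ω t).2) => (t : ℝ≥0∞)) _
        (Nat.find_spec h)
    refine h1.trans (le_trans ?_ (ENNReal.sum_le_tsum (Finset.range (Nat.find h))))
    rw [Finset.sum_congr rfl fun t ht => if_neg (Nat.find_min h (Finset.mem_range.1 ht))]
    simp
  · push Not at h
    simp [h]

/-- A bounded Lyapunov function for a coalescing coupling bounds the expected meeting time. -/
theorem expectedMeetingTime_le {S : Type} [Countable S] [MeasurableSpace S]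
    [DiscreteMeasurableSpace S] (Q : S × S → PMF (S × S)) (hQ : Coalesces Q)
    (V : S × S → ℝ≥0∞) (A : ℝ≥0∞) (hA : ∀ z, V z ≤ A) (hdiag : ∀ x, V (x, x) = 0)
    (hV : ∀ z : S × S, z.1 ≠ z.2 → 1 + ∫⁻ w, V w ∂(Q z).toMeasure ≤ V z)
    (x : S) (π : PMF S) : expectedMeetingTime Q x π ≤ A := by
  classical
  unfold expectedMeetingTime
  calc _ ≤ ∫⁻ ω, ∑' t : ℕ, (if (ω t).1 = (ω t).2 then 0 else 1 : ℝ≥0∞)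
        ∂(chainLaw (π.map fun y => (x, y)) Q) := lintegral_mono meetingTime_le_tsum
    _ ≤ ∫⁻ z, V z ∂(π.map fun y => (x, y)).toMeasure := by
        refine lintegral_chainLaw_tsum_le _ Q (fun z => if z.1 = z.2 then 0 else 1) V ?_
        rintro ⟨a, b⟩
        by_cases hab : a = b
        · subst hab
          simp only [if_true, zero_add, hdiag, nonpos_iff_eq_zero]
          rw [lintegral_countable']
          refine ENNReal.tsum_eq_zero.2 fun w => ?_
          by_cases hw : w ∈ (Q (a, a)).support
          · have : w = (w.1, w.1) := Prod.ext rfl (hQ a w hw).symm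
            rw [this, hdiag, zero_mul]
          · rw [PMF.toMeasure_apply_singleton _ _ (MeasurableSet.of_discrete),
              (PMF.apply_eq_zero_iff _ _).2 hw, mul_zero]
        · simpa [hab] using hV (a, b) hab
    _ ≤ ∫⁻ _, A ∂(π.map fun y => (x, y)).toMeasure := lintegral_mono hA
    _ = A := by simp

/-! ### Expected hitting times and Dirichlet energy -/

section Potential

variable {Z K : Type} [Fintype K]

/-- The mean of `f` over the `K` equally likely successors `φ k z` of `z`. -/
noncomputable def stepMean (φ : K → Z → Z) (f : Z → ℝ) (z : Z) : ℝ :=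
  (∑ k, f (φ k z)) / Fintype.card K

theorem stepMean_mono (φ : K → Z → Z) : Monotone (stepMean φ) := by
  intro f g h z
  unfold stepMean
  gcongr
  exact h _

theorem continuous_stepMean (φ : K → Z → Z) : Continuous (stepMean φ) := by
  unfold stepMean
  fun_prop

theorem stepMean_zero (φ : K → Z → Z) : stepMean φ 0 = 0 := by
  ext z; simp [stepMean]

theorem stepMean_le [Nonempty K] (φ : K → Z → Z) {f : Z → ℝ} {z : Z} {c : ℝ}
    (h : ∀ k, f (φ k z) ≤ c) : stepMean φ f z ≤ c := by
  unfold stepMean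
  rw [div_le_iff₀ (by exact_mod_cast Fintype.card_pos)]
  calc ∑ k, f (φ k z) ≤ ∑ _k : K, c := Finset.sum_le_sum fun k _ => h k
    _ = c * Fintype.card K := by simp [mul_comm]

theorem stepMean_sub_mul (φ : K → Z → Z) (f g : Z → ℝ) (c : ℝ) (z : Z) :
    stepMean φ (fun z => f z - c * g z) z = stepMean φ f z - c * stepMean φ g z := by
  unfold stepMean
  rw [Finset.sum_sub_distrib, ← Finset.mul_sum, sub_div, mul_div_assoc]

/-- Minimal expected costs exist: the iterates `h ↦ 1 + P h` (kept at `0` on `T`) increase, and an a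
priori bound on all subsolutions makes them converge to a solution. -/
theorem exists_expected_hitting (T : Set Z) (P : (Z → ℝ) → Z → ℝ) (hmono : Monotone P)
    (hcont : Continuous P) (h0 : 0 ≤ P 0) (A : ℝ)
    (hA : ∀ h : Z → ℝ, 0 ≤ h → (∀ z ∈ T, h z = 0) → (∀ z ∉ T, h z ≤ 1 + P h z) → ∀ z, h z ≤ A) :
    ∃ H : Z → ℝ, 0 ≤ H ∧ (∀ z, H z ≤ A) ∧ (∀ z ∈ T, H z = 0) ∧ ∀ z ∉ T, H z = 1 + P H z := by
  classical
  let Φ : (Z → ℝ) → Z → ℝ := fun h z => if z ∈ T then 0 else 1 + P h z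
  have hΦm : Monotone Φ := by
    intro f g hfg z
    by_cases hz : z ∈ T
    · simp [Φ, hz]
    · simpa [Φ, hz] using hmono hfg z
  let u : ℕ → Z → ℝ := fun k => Φ^[k] 0
  have us : ∀ k, u (k + 1) = Φ (u k) := fun k => Function.iterate_succ_apply' Φ k 0
  have h01 : (0 : Z → ℝ) ≤ Φ 0 := by
    intro z
    by_cases hz : z ∈ T
    · simp [Φ, hz]
    · have := h0 z
      simp only [Φ, hz, if_false, Pi.zero_apply] at this ⊢
      linarith
  have um : Monotone u := hΦm.monotone_iterate_of_le_map h01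
  have u0 : ∀ k, 0 ≤ u k := fun k => um (Nat.zero_le k)
  have uT : ∀ k, ∀ z ∈ T, u k z = 0 := by
    intro k z hz
    cases k with
    | zero => rfl
    | succ k => rw [us]; simp [Φ, hz]
  have uP : ∀ k, ∀ z ∉ T, u k z ≤ 1 + P (u k) z := by
    intro k z hz
    have := um (Nat.le_succ k) z
    rw [Nat.succ_eq_add_one, us] at this
    simpa [Φ, hz] using this
  have uA : ∀ k z, u k z ≤ A := fun k => hA _ (u0 k) (uT k) (uP k)
  have hlim : ∀ z, ∃ l, Tendsto (fun k => u k z) atTop (nhds l) := fun z =>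
    ⟨_, tendsto_atTop_ciSup (fun i j hij => um hij z) ⟨A, by rintro _ ⟨k, rfl⟩; exact uA k z⟩⟩
  choose H hH using hlim
  have hHu : Tendsto u atTop (nhds H) := tendsto_pi_nhds.2 hH
  refine ⟨H, fun z => ge_of_tendsto' (hH z) fun k => u0 k z,
    fun z => le_of_tendsto' (hH z) fun k => uA k z, fun z hz => ?_, fun z hz => ?_⟩
  · exact tendsto_nhds_unique (hH z) (by simp [uT _ z hz])
  · have h1 : Tendsto (fun k => u (k + 1) z) atTop (nhds (H z)) :=
      (hH z).comp (tendsto_add_atTop_nat 1)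
    have h2 : Tendsto (fun k => 1 + P (u k) z) atTop (nhds (1 + P H z)) :=
      tendsto_const_nhds.add ((tendsto_pi_nhds.1 ((hcont.tendsto H).comp hHu)) z)
    refine tendsto_nhds_unique h1 (h2.congr fun k => ?_)
    rw [us]; simp [Φ, hz]

/-- Comparison principle: up to a factor `2` a supersolution dominates a subsolution. The factor
makes the inequality strict, so that `w - 2 H` cannot attain its maximum off `T`. -/
theorem le_of_subsolution_of_supersolution [Finite Z] [Nonempty K] (φ : K → Z → Z) (C T : Set Z)
    (hC : ∀ z ∈ C, z ∉ T → ∀ k, φ k z ∈ C) (w H : Z → ℝ) (M : ℝ) (hH0 : ∀ z, 0 ≤ H z)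
    (hw : ∀ z ∈ C, z ∉ T → w z ≤ 1 + stepMean φ w z)
    (hH : ∀ z ∈ C, z ∉ T → 1 + stepMean φ H z ≤ H z)
    (hM : ∀ z ∈ C, z ∈ T → w z ≤ M) : ∀ z ∈ C, w z ≤ 2 * H z + M := by
  intro z hz
  obtain ⟨m, hmC, hm⟩ := Set.exists_max_image C (fun z => w z - 2 * H z) (Set.toFinite C) ⟨z, hz⟩
  have hzm := hm z hz
  by_cases hmT : m ∈ T
  · linarith [hM m hmC hmT, hH0 m]
  · have h1 : stepMean φ (fun z => w z - 2 * H z) m ≤ w m - 2 * H m :=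
      stepMean_le φ fun k => hm _ (hC m hmC hmT k)
    rw [stepMean_sub_mul] at h1
    linarith [hw m hmC hmT, hH m hmC hmT]

variable [Fintype Z]

/-- The Dirichlet energy of `f` along the moves `φ`. -/
noncomputable def energy (φ : K → Z → Z) (f : Z → ℝ) : ℝ := ∑ z, ∑ k, (f (φ k z) - f z) ^ 2

theorem energy_nonneg (φ : K → Z → Z) (f : Z → ℝ) : 0 ≤ energy φ f := by
  unfold energy; positivity

theorem sum_sq_le_energy (φ : K → Z → Z) (f : Z → ℝ) (k : K) :
    ∑ z, (f (φ k z) - f z) ^ 2 ≤ energy φ f :=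
  Finset.sum_le_sum fun z _ =>
    Finset.single_le_sum (f := fun k => (f (φ k z) - f z) ^ 2) (fun _ _ => sq_nonneg _)
      (Finset.mem_univ k)

theorem abs_sub_le_sqrt_energy (φ : K → Z → Z) (f : Z → ℝ) (k : K) (z : Z) :
    |f (φ k z) - f z| ≤ √(energy φ f) :=
  Real.abs_le_sqrt ((Finset.single_le_sum (f := fun z => (f (φ k z) - f z) ^ 2)
    (fun _ _ => sq_nonneg _) (Finset.mem_univ z)).trans (sum_sq_le_energy φ f k))

/-- Along bijections the uniform distribution is invariant, so the energy equals
`2 |K| ⟨h, h - P h⟩`, and `h - P h ≤ 1` wherever `h` does not vanish. -/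
theorem energy_le_of_subsolution [Nonempty K] (φ : K → Z → Z) (hφ : ∀ k, (φ k).Bijective)
    (T : Set Z) (h : Z → ℝ) (h0 : ∀ z, 0 ≤ h z) (hT : ∀ z ∈ T, h z = 0)
    (hP : ∀ z ∉ T, h z ≤ 1 + stepMean φ h z) :
    energy φ h ≤ 2 * Fintype.card K * ∑ z, h z := by
  have hK : (0 : ℝ) < Fintype.card K := by exact_mod_cast Fintype.card_pos
  have e1 : energy φ h = 2 * Fintype.card K * ∑ z, h z * (h z - stepMean φ h z) := by
    have a1 : ∀ k, ∑ z, h (φ k z) ^ 2 = ∑ z, h z ^ 2 := fun k =>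
      Fintype.sum_bijective (φ k) (hφ k) _ _ fun _ => rfl
    have a2 : ∀ z, ∑ k, h (φ k z) = Fintype.card K * stepMean φ h z := fun z => by
      unfold stepMean; field_simp
    calc energy φ h = ∑ z, ∑ k, (h (φ k z) ^ 2 + h z ^ 2 - 2 * h z * h (φ k z)) := by
          unfold energy
          refine Finset.sum_congr rfl fun z _ => Finset.sum_congr rfl fun k _ => by ring
      _ = (∑ k, ∑ z, h (φ k z) ^ 2) + ∑ z, ∑ _k : K, h z ^ 2
            - ∑ z, 2 * h z * ∑ k, h (φ k z) := by
          simp only [Finset.sum_sub_distrib, Finset.sum_add_distrib, Finset.mul_sum]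
          rw [Finset.sum_comm (f := fun z k => h (φ k z) ^ 2)]
      _ = _ := by
          simp only [a1, a2, Finset.sum_const, Finset.card_univ, nsmul_eq_mul, Finset.mul_sum]
          rw [← Finset.sum_add_distrib, ← Finset.sum_sub_distrib]
          refine Finset.sum_congr rfl fun z _ => by ring
  rw [e1]
  refine mul_le_mul_of_nonneg_left (Finset.sum_le_sum fun z _ => ?_) (by positivity)
  by_cases hz : z ∈ T
  · simp [hT z hz]
  · exact mul_le_of_le_one_right (h0 z) (by linarith [hP z hz])

end Potential

/-! ### Random walks on the board -/

section BoardWalk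

variable {n : ℕ} {K : Type} [Fintype K]

theorem sum_board_le [NeZero n] {f : Board n → ℝ} {c : ℝ} (h : ∀ z, f z ≤ c) :
    ∑ z, f z ≤ (n : ℝ) ^ 2 * c := by
  calc ∑ z, f z ≤ ∑ _z : Board n, c := Finset.sum_le_sum fun z _ => h z
    _ = (n : ℝ) ^ 2 * c := by simp [ZMod.card, sq]

/-- A walk on the torus whose steps include the two unit vectors hits the origin in expected time
`O(n ^ 4)`. The bound is far from sharp; it only uses that the graph has diameter `O(n)`. -/
theorem exists_expected_hitting_zero [NeZero n] (sh : K → Board n) (k₁ k₂ : K)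
    (h₁ : sh k₁ = (1, 0)) (h₂ : sh k₂ = (0, 1)) :
    ∃ H : Board n → ℝ, (∀ z, 0 ≤ H z) ∧ (∀ z, H z ≤ 8 * Fintype.card K * (n : ℝ) ^ 4) ∧
      ∀ z ≠ 0, 1 + stepMean (fun k z => z + sh k) H z ≤ H z := by
  have : Nonempty K := ⟨k₁⟩
  set φ : K → Board n → Board n := fun k z => z + sh k with hφ
  have hn : (0 : ℝ) < n := by exact_mod_cast NeZero.pos n
  have line : ∀ (f : Board n → ℝ) (k : K) (z : Board n) (i : ℕ),
      |f (z + i • sh k) - f z| ≤ i * √(energy φ f) := by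
    intro f k z i
    induction i with
    | zero => simp
    | succ i ih =>
      have h := abs_sub_le_sqrt_energy φ f k (z + i • sh k)
      have e : φ k (z + i • sh k) = z + (i + 1) • sh k := by simp only [hφ]; rw [succ_nsmul]; abel
      rw [e] at h
      have := abs_sub_le (f (z + (i + 1) • sh k)) (f (z + i • sh k)) (f z)
      push_cast
      linarith
  have diam : ∀ (f : Board n → ℝ) (x : Board n), |f x - f 0| ≤ 2 * n * √(energy φ f) := by
    intro f x
    have a := line f k₁ 0 x.1.val
    have b := line f k₂ (0 + x.1.val • sh k₁) x.2.val
    have e : 0 + x.1.val • sh k₁ + x.2.val • sh k₂ = x := by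
      rw [h₁, h₂]; ext <;> simp
    rw [e] at b
    have hs := Real.sqrt_nonneg (energy φ f)
    have c1 : (x.1.val : ℝ) ≤ n := by exact_mod_cast (ZMod.val_lt x.1).le
    have c2 : (x.2.val : ℝ) ≤ n := by exact_mod_cast (ZMod.val_lt x.2).le
    have := abs_sub_le (f x) (f (0 + x.1.val • sh k₁)) (f 0)
    nlinarith [mul_le_mul_of_nonneg_right c1 hs, mul_le_mul_of_nonneg_right c2 hs]
  obtain ⟨H, H0, HA, -, HP⟩ := exists_expected_hitting ({0} : Set (Board n)) (stepMean φ)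
    (stepMean_mono φ) (continuous_stepMean φ) (by rw [stepMean_zero])
    (8 * Fintype.card K * (n : ℝ) ^ 4) (by
      intro h h0 hT hP
      obtain ⟨m, hm⟩ := Finite.exists_max h
      have hE := energy_le_of_subsolution φ (fun k => (Equiv.addRight (sh k)).bijective) {0} h h0
        hT hP
      have hd := diam h m
      rw [hT 0 rfl, sub_zero, abs_of_nonneg (h0 m)] at hd
      have hsum := sum_board_le hm
      have hK : (0 : ℝ) < Fintype.card K := by exact_mod_cast Fintype.card_pos
      have h1 : h m ^ 2 ≤ (2 * n) ^ 2 * energy φ h := by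
        rw [← Real.sq_sqrt (energy_nonneg φ h), ← mul_pow]
        exact pow_le_pow_left₀ (h0 m) hd 2
      have h2 : h m ^ 2 ≤ (8 * Fintype.card K * (n : ℝ) ^ 4) * h m := by
        calc h m ^ 2 ≤ (2 * n) ^ 2 * (2 * Fintype.card K * ((n : ℝ) ^ 2 * h m)) :=
              h1.trans (by gcongr; exact hE.trans (by gcongr))
          _ = _ := by ring
      intro z
      refine (hm z).trans ?_
      rcases (h0 m).eq_or_lt with h3 | h3
      · simp only [Pi.zero_apply] at h3; rw [← h3]; positivity
      · simp only [Pi.zero_apply] at h3; nlinarith)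
  exact ⟨H, H0, HA, fun z hz => (HP z hz).ge⟩

end BoardWalk

/-! ### Resistance of the square grid -/

section Grid

open Finset.HasAntidiagonal (antidiagonal mem_antidiagonal)

/-- The mean of `F` over the antidiagonal `i + j = k`. -/
noncomputable def diagMean (F : ℕ → ℕ → ℝ) (k : ℕ) : ℝ :=
  (∑ p ∈ antidiagonal k, F p.1 p.2) / (k + 1)

/-- The part of the Dirichlet energy of `F` on the edges from `i + j = k` to `i + j = k + 1`. -/
noncomputable def diagEnergy (F : ℕ → ℕ → ℝ) (k : ℕ) : ℝ :=
  ∑ p ∈ antidiagonal k, ((F (p.1 + 1) p.2 - F p.1 p.2) ^ 2 +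
    (F p.1 (p.2 + 1) - F p.1 p.2) ^ 2)

/-- Consecutive antidiagonal means differ by a mean of differences along edges. Sending the mass
at `(i, j)` right with weight `i + 1` and up with weight `j + 1` carries the uniform distribution on
one antidiagonal to the uniform distribution on the next one. -/
theorem diagMean_succ_sub (F : ℕ → ℕ → ℝ) (k : ℕ) :
    diagMean F (k + 1) - diagMean F k = (∑ p ∈ antidiagonal k,
      (((p.1 : ℝ) + 1) / (k + 2) * (F (p.1 + 1) p.2 - F p.1 p.2) +
        ((p.2 : ℝ) + 1) / (k + 2) * (F p.1 (p.2 + 1) - F p.1 p.2))) / (k + 1) := by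
  have a1 := Finset.Nat.sum_antidiagonal_succ (n := k)
    (f := fun p : ℕ × ℕ => (p.1 : ℝ) * F p.1 p.2)
  have a2 := Finset.Nat.sum_antidiagonal_succ' (n := k)
    (f := fun p : ℕ × ℕ => (p.2 : ℝ) * F p.1 p.2)
  simp only [Nat.cast_zero, zero_mul, zero_add, Nat.cast_add, Nat.cast_one] at a1 a2
  have a3 : ∑ p ∈ antidiagonal (k + 1), (p.1 : ℝ) * F p.1 p.2 +
      ∑ p ∈ antidiagonal (k + 1), (p.2 : ℝ) * F p.1 p.2 =
      (k + 1) * ∑ p ∈ antidiagonal (k + 1), F p.1 p.2 := by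
    rw [← Finset.sum_add_distrib, Finset.mul_sum]
    refine Finset.sum_congr rfl fun p hp => ?_
    have : (p.1 : ℝ) + p.2 = k + 1 := by exact_mod_cast mem_antidiagonal.1 hp
    rw [← this]; ring
  rw [a1, a2] at a3
  have hk : (0 : ℝ) < k + 1 := by positivity
  have hk2 : (0 : ℝ) < k + 2 := by positivity
  have a4 : ∑ p ∈ antidiagonal k,
      (((p.1 : ℝ) + 1) / (k + 2) * (F (p.1 + 1) p.2 - F p.1 p.2) +
        ((p.2 : ℝ) + 1) / (k + 2) * (F p.1 (p.2 + 1) - F p.1 p.2)) =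
      (∑ p ∈ antidiagonal k, ((p.1 : ℝ) + 1) * F (p.1 + 1) p.2 +
       ∑ p ∈ antidiagonal k, ((p.2 : ℝ) + 1) * F p.1 (p.2 + 1)) / (k + 2) -
        ∑ p ∈ antidiagonal k, F p.1 p.2 := by
    rw [← Finset.sum_add_distrib, Finset.sum_div, ← Finset.sum_sub_distrib]
    refine Finset.sum_congr rfl fun p hp => ?_
    have : (k : ℝ) = p.1 + p.2 := by exact_mod_cast (mem_antidiagonal.1 hp).symm
    rw [this] at hk2 ⊢
    field_simp
    ring
  rw [a4, a3]
  unfold diagMean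
  push_cast
  field_simp
  ring

theorem sq_diagMean_succ_sub_le (F : ℕ → ℕ → ℝ) (k : ℕ) :
    (diagMean F (k + 1) - diagMean F k) ^ 2 ≤ (1 / (k + 1)) * diagEnergy F k := by
  have hk : (0 : ℝ) < k + 1 := by positivity
  rw [diagMean_succ_sub, div_pow, div_le_iff₀ (by positivity)]
  refine sq_sum_le_card_mul_sum_sq.trans ?_
  rw [Finset.Nat.card_antidiagonal]
  have e : 1 / ((k : ℝ) + 1) * diagEnergy F k * (k + 1) ^ 2 = (k + 1) * diagEnergy F k := by
    field_simp
  rw [e]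
  push_cast
  refine mul_le_mul_of_nonneg_left (Finset.sum_le_sum fun p hp => ?_) hk.le
  have hp : (p.1 : ℝ) + p.2 = k := by exact_mod_cast mem_antidiagonal.1 hp
  set X := F (p.1 + 1) p.2 - F p.1 p.2
  set Y := F p.1 (p.2 + 1) - F p.1 p.2
  have hw : ((p.2 : ℝ) + 1) / (k + 2) = 1 - ((p.1 : ℝ) + 1) / (k + 2) := by
    rw [← hp]; field_simp; ring
  have hw0 : 0 ≤ ((p.1 : ℝ) + 1) / (k + 2) := by positivity
  have hw1 : 0 ≤ ((p.2 : ℝ) + 1) / (k + 2) := by positivity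
  rw [hw] at hw1 ⊢
  set w := ((p.1 : ℝ) + 1) / (k + 2)
  nlinarith [mul_nonneg (mul_nonneg hw0 hw1) (sq_nonneg (X - Y)), mul_nonneg hw0 (sq_nonneg Y),
    mul_nonneg hw1 (sq_nonneg X)]

/-- The antidiagonals carry disjoint energies and the resistance between consecutive ones is at most
`1 / (k + 1)`; adding up gives the logarithm. -/
theorem sq_diagMean_sub_le (F : ℕ → ℕ → ℝ) (K : ℕ) :
    (diagMean F K - F 0 0) ^ 2 ≤
      (∑ k ∈ Finset.range K, 1 / ((k : ℝ) + 1)) * ∑ k ∈ Finset.range K, diagEnergy F k := by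
  have h0 : diagMean F 0 = F 0 0 := by simp [diagMean]
  rw [← h0, ← Finset.sum_range_sub]
  have hE : ∀ k, 0 ≤ diagEnergy F k := fun k => Finset.sum_nonneg fun _ _ => by positivity
  have h1 : |∑ k ∈ Finset.range K, (diagMean F (k + 1) - diagMean F k)| ≤
      ∑ k ∈ Finset.range K, √(1 / ((k : ℝ) + 1)) * √(diagEnergy F k) := by
    refine (Finset.abs_sum_le_sum_abs _ _).trans (Finset.sum_le_sum fun k _ => ?_)
    rw [← Real.sqrt_mul (by positivity)]
    exact Real.abs_le_sqrt (sq_diagMean_succ_sub_le F k)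
  have h2 := Finset.sum_mul_sq_le_sq_mul_sq (Finset.range K)
    (fun k : ℕ => √(1 / ((k : ℝ) + 1))) (fun k => √(diagEnergy F k))
  rw [← sq_abs]
  refine (pow_le_pow_left₀ (abs_nonneg _) h1 2).trans (h2.trans_eq ?_)
  congr 1
  · exact Finset.sum_congr rfl fun k _ => Real.sq_sqrt (by positivity)
  · exact Finset.sum_congr rfl fun k _ => Real.sq_sqrt (hE k)

theorem sum_range_one_div_le (K m : ℕ) (h : K ≤ m) :
    ∑ k ∈ Finset.range K, 1 / ((k : ℝ) + 1) ≤ 1 + Real.log m := by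
  calc ∑ k ∈ Finset.range K, 1 / ((k : ℝ) + 1)
      ≤ ∑ k ∈ Finset.range m, 1 / ((k : ℝ) + 1) :=
        Finset.sum_le_sum_of_subset_of_nonneg (Finset.range_mono h) fun _ _ _ => by positivity
    _ = (harmonic m : ℝ) := by simp [harmonic]
    _ ≤ 1 + Real.log m := harmonic_le_one_add_log m

/-- The box `[1, m] × [1, m]`. -/
def gridBox (m : ℤ) : Set (ℤ × ℤ) := {p | 1 ≤ p.1 ∧ p.1 ≤ m ∧ 1 ≤ p.2 ∧ p.2 ≤ m}

/-- `F` has Dirichlet energy at most `E` on the horizontal edges of the box and at most `E` on its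
vertical edges. -/
structure GridEnergyLE (m : ℤ) (F : ℤ × ℤ → ℝ) (E : ℝ) : Prop where
  hor : ∀ A : Finset (ℤ × ℤ), (∀ p ∈ A, p ∈ gridBox m ∧ p + (1, 0) ∈ gridBox m) →
    ∑ p ∈ A, (F (p + (1, 0)) - F p) ^ 2 ≤ E
  ver : ∀ A : Finset (ℤ × ℤ), (∀ p ∈ A, p ∈ gridBox m ∧ p + (0, 1) ∈ gridBox m) →
    ∑ p ∈ A, (F (p + (0, 1)) - F p) ^ 2 ≤ E

theorem sum_cone (g : ℕ × ℕ → ℝ) (K : ℕ) :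
    ∑ k ∈ Finset.range K, ∑ p ∈ antidiagonal k, g p =
      ∑ p ∈ (Finset.range K ×ˢ Finset.range K).filter (fun p => p.1 + p.2 < K), g p := by
  rw [← Finset.sum_fiberwise_of_maps_to (t := Finset.range K) (g := fun p : ℕ × ℕ => p.1 + p.2)
    (by simp)]
  refine Finset.sum_congr rfl fun k hk => Finset.sum_congr ?_ fun _ _ => rfl
  ext p
  simp only [Finset.mem_range, mem_antidiagonal, Finset.mem_filter, Finset.mem_product] at *
  omega

/-- A cone with apex `x` and `K` antidiagonals, opening in the direction `(σ, τ)`. -/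
theorem GridEnergyLE.cone {m : ℤ} {F : ℤ × ℤ → ℝ} {E : ℝ} (h : GridEnergyLE m F E) (x : ℤ × ℤ)
    (σ τ : ℤ) (hσ : σ = 1 ∨ σ = -1) (hτ : τ = 1 ∨ τ = -1) (K : ℕ) (hx : x ∈ gridBox m)
    (hy : x + (σ * K, τ * K) ∈ gridBox m) :
    |diagMean (fun i j => F (x + (σ * i, τ * j))) K - F x| ≤
      √((1 + Real.log m) * (2 * E)) := by
  set G : ℕ → ℕ → ℝ := fun i j => F (x + (σ * i, τ * j)) with hG
  obtain ⟨x₁, x₂⟩ := x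
  simp only [gridBox, Set.mem_ofPred_eq, Prod.mk_add_mk] at hx hy
  set D := (Finset.range K ×ˢ Finset.range K).filter (fun p => p.1 + p.2 < K) with hD
  have memD : ∀ p ∈ D, p.1 < K ∧ p.2 < K := by
    intro p hp; simp [hD] at hp; omega
  have e0 : F (x₁, x₂) = G 0 0 := by simp [hG]
  rw [e0]
  refine Real.abs_le_sqrt ((sq_diagMean_sub_le G K).trans ?_)
  have e1 : ∑ k ∈ Finset.range K, diagEnergy G k =
      ∑ p ∈ D, (G (p.1 + 1) p.2 - G p.1 p.2) ^ 2 + ∑ p ∈ D, (G p.1 (p.2 + 1) - G p.1 p.2) ^ 2 := by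
    rw [← Finset.sum_add_distrib, ← sum_cone]
    rfl
  have b1 : ∑ p ∈ D, (G (p.1 + 1) p.2 - G p.1 p.2) ^ 2 ≤ E := by
    rcases hσ with rfl | rfl
    · let ψ : ℕ × ℕ → ℤ × ℤ := fun p => (x₁ + p.1, x₂ + τ * p.2)
      have hψ : Set.InjOn ψ D := by
        rintro p - q - hpq
        simp only [ψ, Prod.mk.injEq] at hpq
        ext <;> rcases hτ with rfl | rfl <;> omega
      have := h.hor (D.image ψ) (by
        intro q hq
        obtain ⟨p, hp, rfl⟩ := Finset.mem_image.1 hq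
        have := memD p hp
        simp only [ψ, gridBox, Set.mem_ofPred_eq, Prod.mk_add_mk]
        rcases hτ with rfl | rfl <;> omega)
      rw [Finset.sum_image hψ] at this
      refine le_of_eq_of_le (Finset.sum_congr rfl fun p _ => ?_) this
      simp only [hG, ψ, Prod.mk_add_mk]
      congr 4 <;> push_cast <;> ring
    · let ψ : ℕ × ℕ → ℤ × ℤ := fun p => (x₁ - p.1 - 1, x₂ + τ * p.2)
      have hψ : Set.InjOn ψ D := by
        rintro p - q - hpq
        simp only [ψ, Prod.mk.injEq] at hpq
        ext <;> rcases hτ with rfl | rfl <;> omega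
      have := h.hor (D.image ψ) (by
        intro q hq
        obtain ⟨p, hp, rfl⟩ := Finset.mem_image.1 hq
        have := memD p hp
        simp only [ψ, gridBox, Set.mem_ofPred_eq, Prod.mk_add_mk]
        rcases hτ with rfl | rfl <;> omega)
      rw [Finset.sum_image hψ] at this
      refine le_of_eq_of_le (Finset.sum_congr rfl fun p _ => ?_) this
      simp only [hG, ψ, Prod.mk_add_mk]
      rw [← neg_sub, neg_sq]
      congr 4 <;> push_cast <;> ring
  have b2 : ∑ p ∈ D, (G p.1 (p.2 + 1) - G p.1 p.2) ^ 2 ≤ E := by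
    rcases hτ with rfl | rfl
    · let ψ : ℕ × ℕ → ℤ × ℤ := fun p => (x₁ + σ * p.1, x₂ + p.2)
      have hψ : Set.InjOn ψ D := by
        rintro p - q - hpq
        simp only [ψ, Prod.mk.injEq] at hpq
        ext <;> rcases hσ with rfl | rfl <;> omega
      have := h.ver (D.image ψ) (by
        intro q hq
        obtain ⟨p, hp, rfl⟩ := Finset.mem_image.1 hq
        have := memD p hp
        simp only [ψ, gridBox, Set.mem_ofPred_eq, Prod.mk_add_mk]
        rcases hσ with rfl | rfl <;> omega)
      rw [Finset.sum_image hψ] at this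
      refine le_of_eq_of_le (Finset.sum_congr rfl fun p _ => ?_) this
      simp only [hG, ψ, Prod.mk_add_mk]
      congr 4 <;> push_cast <;> ring
    · let ψ : ℕ × ℕ → ℤ × ℤ := fun p => (x₁ + σ * p.1, x₂ - p.2 - 1)
      have hψ : Set.InjOn ψ D := by
        rintro p - q - hpq
        simp only [ψ, Prod.mk.injEq] at hpq
        ext <;> rcases hσ with rfl | rfl <;> omega
      have := h.ver (D.image ψ) (by
        intro q hq
        obtain ⟨p, hp, rfl⟩ := Finset.mem_image.1 hq
        have := memD p hp
        simp only [ψ, gridBox, Set.mem_ofPred_eq, Prod.mk_add_mk]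
        rcases hσ with rfl | rfl <;> omega)
      rw [Finset.sum_image hψ] at this
      refine le_of_eq_of_le (Finset.sum_congr rfl fun p _ => ?_) this
      simp only [hG, ψ, Prod.mk_add_mk]
      rw [← neg_sub, neg_sq]
      congr 4 <;> push_cast <;> ring
  have hm1 : 1 ≤ m := by omega
  have hlog : ∑ k ∈ Finset.range K, 1 / ((k : ℝ) + 1) ≤ 1 + Real.log m := by
    obtain ⟨m', rfl⟩ := Int.eq_ofNat_of_zero_le (by omega : 0 ≤ m)
    have := sum_range_one_div_le K m' (by
      rcases hσ with rfl | rfl <;> omega)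
    simpa using this
  rw [e1]
  have hs : 0 ≤ ∑ p ∈ D, (G (p.1 + 1) p.2 - G p.1 p.2) ^ 2 +
      ∑ p ∈ D, (G p.1 (p.2 + 1) - G p.1 p.2) ^ 2 := by positivity
  have hl : 0 ≤ Real.log m := Real.log_nonneg (by exact_mod_cast hm1)
  exact mul_le_mul hlog (by linarith) hs (by linarith)

/-- Opposite corners of a square share the antidiagonal of that square. -/
theorem GridEnergyLE.square {m : ℤ} {F : ℤ × ℤ → ℝ} {E : ℝ} (h : GridEnergyLE m F E) (x : ℤ × ℤ)
    (σ τ : ℤ) (hσ : σ = 1 ∨ σ = -1) (hτ : τ = 1 ∨ τ = -1) (K : ℕ) (hx : x ∈ gridBox m)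
    (hy : x + (σ * K, τ * K) ∈ gridBox m) :
    |F (x + (σ * K, τ * K)) - F x| ≤ 2 * √((1 + Real.log m) * (2 * E)) := by
  have a := h.cone x σ τ hσ hτ K hx hy
  have b := h.cone (x + (σ * K, τ * K)) (-σ) (-τ) (by omega) (by omega) K hy (by
    convert hx using 1
    ext <;> simp)
  have e : diagMean (fun i j => F (x + (σ * K, τ * K) + (-σ * i, -τ * j))) K =
      diagMean (fun i j => F (x + (σ * i, τ * j))) K := by
    unfold diagMean
    congr 1
    rw [← Finset.Nat.sum_antidiagonal_swap]
    refine Finset.sum_congr rfl fun p hp => ?_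
    have : (K : ℤ) = p.1 + p.2 := by exact_mod_cast (mem_antidiagonal.1 hp).symm
    rw [this]
    refine congrArg F (Prod.ext ?_ ?_) <;> simp <;> ring
  rw [e] at b
  have := abs_sub_le (F (x + (σ * K, τ * K))) (diagMean (fun i j => F (x + (σ * i, τ * j))) K) (F x)
  rw [abs_sub_comm] at b
  linarith

theorem GridEnergyLE.corner_of_even {m : ℤ} {F : ℤ × ℤ → ℝ} {E : ℝ} (h : GridEnergyLE m F E)
    (p q : ℤ) (hpq : (p, q) ∈ gridBox m) (he : Even (p + q)) :
    |F (p, q) - F (1, 1)| ≤ 4 * √((1 + Real.log m) * (2 * E)) := by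
  obtain ⟨r, hr⟩ := he
  simp only [gridBox, Set.mem_ofPred_eq] at hpq
  -- the squares with opposite corners `(1, 1)`, `(r, r)` and `(r, r)`, `(p, q)` stay in the box
  obtain ⟨K, hK⟩ := Int.eq_ofNat_of_zero_le (by omega : 0 ≤ r - 1)
  have a := h.square (1, 1) 1 1 (by simp) (by simp) K (by simp [gridBox]; omega)
    (by simp [gridBox]; omega)
  have e1 : ((1, 1) : ℤ × ℤ) + (1 * (K : ℤ), 1 * (K : ℤ)) = (r, r) := by ext <;> simp <;> omega
  rw [e1] at a
  obtain ⟨σ, L, hσ, e2⟩ : ∃ (σ : ℤ) (L : ℕ), (σ = 1 ∨ σ = -1) ∧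
      ((r, r) : ℤ × ℤ) + (σ * L, (-σ) * L) = (p, q) := by
    rcases le_total r p with hp | hp
    · exact ⟨1, (p - r).toNat, by simp, by ext <;> simp <;> omega⟩
    · exact ⟨-1, (r - p).toNat, by simp, by ext <;> simp <;> omega⟩
  have b := h.square (r, r) σ (-σ) hσ (by omega) L (by simp [gridBox]; omega)
    (by rw [e2]; simpa [gridBox] using hpq)
  rw [e2] at b
  have := abs_sub_le (F (p, q)) (F (r, r)) (F (1, 1))
  linarith

/-- In a box of side `m` the potential difference to a corner is `O(√(log m · E))`. -/
theorem GridEnergyLE.corner {m : ℤ} {F : ℤ × ℤ → ℝ} {E : ℝ} (h : GridEnergyLE m F E)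
    (p q : ℤ) (hpq : (p, q) ∈ gridBox m) :
    |F (p, q) - F (1, 1)| ≤ 4 * √((1 + Real.log m) * (2 * E)) + √E := by
  have hpq' := hpq
  simp only [gridBox, Set.mem_ofPred_eq] at hpq'
  rcases Int.even_or_odd (p + q) with he | ho
  · linarith [h.corner_of_even p q hpq he, Real.sqrt_nonneg E]
  · rcases lt_or_ge 1 p with hp | hp
    · have a := h.corner_of_even (p - 1) q (by simp [gridBox]; omega) (by
        rw [Int.odd_iff] at ho; rw [Int.even_iff]; omega)
      have b := h.hor {(p - 1, q)} (by simp [gridBox]; omega)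
      rw [Finset.sum_singleton] at b
      have b' := Real.abs_le_sqrt b
      simp only [Prod.mk_add_mk, sub_add_cancel, add_zero] at b'
      linarith [abs_sub_le (F (p, q)) (F (p - 1, q)) (F (1, 1))]
    · have hq : 1 < q := by
        rw [Int.odd_iff] at ho; omega
      have a := h.corner_of_even p (q - 1) (by simp [gridBox]; omega) (by
        rw [Int.odd_iff] at ho; rw [Int.even_iff]; omega)
      have b := h.ver {(p, q - 1)} (by simp [gridBox]; omega)
      rw [Finset.sum_singleton] at b
      have b' := Real.abs_le_sqrt b
      simp only [Prod.mk_add_mk, sub_add_cancel, add_zero] at b'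
      linarith [abs_sub_le (F (p, q)) (F (p, q - 1)) (F (1, 1))]

end Grid

/-! ### Displacements relative to the empty square -/

section Relative

/-- Effect of a move `v` of the empty square on the displacement `x` from the empty square to
a piece. It is a permutation of all displacements that fixes the impossible displacement `0`. -/
def relMove {G : Type} [AddCommGroup G] [DecidableEq G] (v x : G) : G := Equiv.swap 0 v x - v

section

variable {G : Type} [AddCommGroup G] [DecidableEq G]

theorem relMove_self (v : G) : relMove v v = -v := by simp [relMove]

theorem relMove_zero_right (v : G) : relMove v 0 = 0 := by simp [relMove]

theorem relMove_of_ne {v x : G} (h0 : x ≠ 0) (h : x ≠ v) : relMove v x = x - v := by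
  simp [relMove, Equiv.swap_apply_of_ne_of_ne h0 h]

theorem relMove_bijective (v : G) : (relMove v).Bijective :=
  ((Equiv.swap 0 v).trans (Equiv.subRight v)).bijective

theorem relMove_ne_zero {v x : G} (h : x ≠ 0) : relMove v x ≠ 0 := fun h' =>
  h ((relMove_bijective v).injective (h'.trans (relMove_zero_right v).symm))

/-- The displacements to two pieces after a move of the empty square. -/
def relStep (δ : Fin 5 → G) (k : Fin 5) (z : G × G) : G × G :=
  (relMove (δ k) z.1, relMove (δ k) z.2)

theorem relStep_bijective (δ : Fin 5 → G) (k : Fin 5) : (relStep δ k).Bijective :=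
  (relMove_bijective (δ k)).prodMap (relMove_bijective (δ k))

/-- Displacement to one piece after a sequence of moves. -/
def relRun (δ : Fin 5 → G) (w : List (Fin 5)) (x : G) : G :=
  w.foldl (fun x k => relMove (δ k) x) x

theorem relRun_injective (δ : Fin 5 → G) (w : List (Fin 5)) : (relRun δ w).Injective := by
  induction w with
  | nil => exact fun _ _ h => h
  | cons k w ih => exact fun _ _ h => (relMove_bijective (δ k)).injective (ih h)

theorem relRun_ne_zero (δ : Fin 5 → G) (w : List (Fin 5)) {x : G} (h : x ≠ 0) :
    relRun δ w x ≠ 0 := by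
  induction w generalizing x with
  | nil => exact h
  | cons k w ih => exact ih (relMove_ne_zero h)

variable [Fintype G]

/-- A run of `L` moves multiplies the energy by at most `L ^ 2`, because every single move permutes
the states. -/
theorem sum_sq_relRun_le (δ : Fin 5 → G) (w : List (Fin 5)) (f : G × G → ℝ) :
    ∑ z : G × G, (f (relRun δ w z.1, relRun δ w z.2) - f z) ^ 2 ≤
      (w.length : ℝ) ^ 2 * energy (relStep δ) f := by
  induction w with
  | nil => simp [relRun]
  | cons k w ih =>
    have hE := energy_nonneg (relStep δ) f
    have h1 := sum_sq_le_energy (relStep δ) f k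
    set L : ℝ := (w.length : ℝ) with hL
    have hL0 : 0 ≤ L := by positivity
    have h2 : ∑ z : G × G, (f (relRun δ w (relStep δ k z).1, relRun δ w (relStep δ k z).2) -
        f (relStep δ k z)) ^ 2 ≤ L ^ 2 * energy (relStep δ) f :=
      ((relStep_bijective δ k).sum_comp fun z =>
        (f (relRun δ w z.1, relRun δ w z.2) - f z) ^ 2).trans_le ih
    set a : G × G → ℝ := fun z =>
      f (relRun δ w (relStep δ k z).1, relRun δ w (relStep δ k z).2) - f (relStep δ k z) with ha
    set b : G × G → ℝ := fun z => f (relStep δ k z) - f z with hb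
    have e : ∀ z : G × G, f (relRun δ (k :: w) z.1, relRun δ (k :: w) z.2) - f z = a z + b z := by
      intro z
      simp only [ha, hb, sub_add_sub_cancel]
      rfl
    simp only [e, List.length_cons, Nat.cast_add, Nat.cast_one, ← hL]
    rcases hL0.eq_or_lt with h0 | h0
    · obtain rfl : w = [] := List.length_eq_zero_iff.1 (by exact_mod_cast hL.symm.trans h0.symm)
      have : ∀ z, a z = 0 := fun z => by simp [ha, relRun]
      simpa [this, ← h0] using h1
    · refine le_of_mul_le_mul_left ?_ h0
      calc L * ∑ z, (a z + b z) ^ 2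
          ≤ (L + 1) * ∑ z, a z ^ 2 + L * (L + 1) * ∑ z, b z ^ 2 := by
            rw [Finset.mul_sum, Finset.mul_sum, Finset.mul_sum, ← Finset.sum_add_distrib]
            exact Finset.sum_le_sum fun z _ => by nlinarith [sq_nonneg (a z - L * b z)]
        _ ≤ (L + 1) * (L ^ 2 * energy (relStep δ) f) + L * (L + 1) * energy (relStep δ) f := by
            gcongr
        _ = L * ((L + 1) ^ 2 * energy (relStep δ) f) := by ring

theorem abs_relRun_sub_le (δ : Fin 5 → G) (w : List (Fin 5)) (f : G × G → ℝ) (x y : G) :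
    |f (relRun δ w x, relRun δ w y) - f (x, y)| ≤ w.length * √(energy (relStep δ) f) := by
  rw [← Real.sqrt_sq (Nat.cast_nonneg w.length), ← Real.sqrt_mul (by positivity)]
  exact Real.abs_le_sqrt ((Finset.single_le_sum
    (f := fun z : G × G => (f (relRun δ w z.1, relRun δ w z.2) - f z) ^ 2)
    (fun _ _ => sq_nonneg _) (Finset.mem_univ (x, y))).trans (sum_sq_relRun_le δ w f))

end

/-- The five moves, as vectors of `ℤ × ℤ`. -/
def intDir : Fin 5 → ℤ × ℤ := ![(0, 0), (1, 0), (-1, 0), (0, 1), (0, -1)]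

/-- Reduction modulo `n`. -/
def toBoard (n : ℕ) (p : ℤ × ℤ) : Board n := (p.1, p.2)

variable {n : ℕ}

theorem toBoard_intDir (k : Fin 5) : toBoard n (intDir k) = Config.dir n k := by
  fin_cases k <;> simp [toBoard, intDir, Config.dir]

theorem toBoard_sub (p q : ℤ × ℤ) : toBoard n (p - q) = toBoard n p - toBoard n q := by
  simp [toBoard]

theorem intCast_zmod_inj {a b : ℤ} (h : |a - b| < n) : (a : ZMod n) = b ↔ a = b := by
  refine ⟨fun e => ?_, fun e => by rw [e]⟩
  have := Int.eq_zero_of_abs_lt_dvd (((ZMod.intCast_eq_intCast_iff_dvd_sub b a n).1 e.symm)) h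
  omega

theorem toBoard_inj {p q : ℤ × ℤ} (h1 : |p.1 - q.1| < n) (h2 : |p.2 - q.2| < n) :
    toBoard n p = toBoard n q ↔ p = q := by
  rw [toBoard, toBoard, Prod.ext_iff, Prod.ext_iff, intCast_zmod_inj h1, intCast_zmod_inj h2]

/-- A displacement that fits, with room to spare, into a board of side at least `9`. -/
def SmallVec (p : ℤ × ℤ) : Prop := |p.1| ≤ 4 ∧ |p.2| ≤ 4

instance : DecidablePred SmallVec := fun p => inferInstanceAs (Decidable (|p.1| ≤ 4 ∧ |p.2| ≤ 4))

theorem toBoard_inj_of_small (hn : 9 ≤ n) {p q : ℤ × ℤ} (hp : SmallVec p) (hq : SmallVec q) :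
    toBoard n p = toBoard n q ↔ p = q := by
  obtain ⟨a, b⟩ := hp
  obtain ⟨c, d⟩ := hq
  rw [abs_le] at a b c d
  apply toBoard_inj <;> rw [abs_lt] <;> omega

theorem smallVec_intDir (k : Fin 5) : SmallVec (intDir k) := by
  fin_cases k <;> decide

/-- A run of moves in the plane that never leaves the window in which reduction modulo `n` is
injective. -/
def SmallRun : List (Fin 5) → ℤ × ℤ → Prop
  | [], _ => True
  | k :: w, p => SmallVec p ∧ SmallRun w (relMove (intDir k) p)

instance decidableSmallRun : ∀ (w : List (Fin 5)) (p : ℤ × ℤ), Decidable (SmallRun w p)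
  | [], _ => inferInstanceAs (Decidable True)
  | k :: w, p =>
    have := decidableSmallRun w (relMove (intDir k) p)
    inferInstanceAs (Decidable (_ ∧ _))

theorem relMove_toBoard (hn : 9 ≤ n) (k : Fin 5) {p : ℤ × ℤ} (hp : SmallVec p) :
    relMove (Config.dir n k) (toBoard n p) = toBoard n (relMove (intDir k) p) := by
  rw [← toBoard_intDir]
  have z : toBoard n 0 = 0 := by simp [toBoard]
  by_cases h0 : p = 0
  · rw [h0, z, relMove_zero_right, relMove_zero_right, z]
  by_cases h1 : p = intDir k
  · rw [h1, relMove_self, relMove_self, ← zero_sub, ← zero_sub, toBoard_sub, z]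
  rw [relMove_of_ne h0 h1, toBoard_sub, relMove_of_ne]
  · rw [← z, ne_eq, toBoard_inj_of_small hn hp (by decide)]
    exact h0
  · rw [ne_eq, toBoard_inj_of_small hn hp (smallVec_intDir k)]
    exact h1

theorem relRun_toBoard (hn : 9 ≤ n) (w : List (Fin 5)) (p q : ℤ × ℤ) (h : SmallRun w p)
    (hq : relRun intDir w p = q) : relRun (Config.dir n) w (toBoard n p) = toBoard n q := by
  subst hq
  induction w generalizing p with
  | nil => rfl
  | cons k w ih =>
    have := ih _ h.2
    rw [← relMove_toBoard hn k h.1] at this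
    exact this

end Relative

/-! ### Bringing two pieces together -/

section TwoPieces

variable {n : ℕ}

theorem intCast_zmod_ne (hn : 9 ≤ n) {a b : ℤ} (h : |a - b| < 9) (hab : a ≠ b) :
    (a : ZMod n) ≠ b := fun e =>
  hab ((intCast_zmod_inj (h.trans_le (by exact_mod_cast hn))).1 e)

theorem relMove_dir_of_snd {k : Fin 5} {x : Board n} (h0 : x.2 ≠ 0)
    (h1 : x.2 ≠ (Config.dir n k).2) :
    relMove (Config.dir n k) x = x - Config.dir n k :=
  relMove_of_ne (fun h => h0 (by rw [h]; rfl)) (fun h => h1 (by rw [h]))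

theorem relMove_dir_of_fst {k : Fin 5} {x : Board n} (h0 : x.1 ≠ 0)
    (h1 : x.1 ≠ (Config.dir n k).1) :
    relMove (Config.dir n k) x = x - Config.dir n k :=
  relMove_of_ne (fun h => h0 (by rw [h]; rfl)) (fun h => h1 (by rw [h]))

/-- The empty square, standing right of a piece, pushes that piece right and goes round it. -/
abbrev pushRight : List (Fin 5) := [2, 3, 1, 1, 4]

/-- The empty square, standing right of a piece, pushes that piece up and returns to its right. -/
abbrev pushUp : List (Fin 5) := [3, 2, 4, 1, 3]

theorem relRun_pushRight_of_snd {x : Board n} (h0 : x.2 ≠ 0) (h1 : x.2 ≠ 1) :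
    relRun (Config.dir n) pushRight x = x - (1, 0) := by
  have h2 : x.2 - 1 ≠ 0 := sub_ne_zero.2 h1
  have h3 : x.2 - 1 ≠ -1 := fun h => h0 (by linear_combination h)
  simp only [relRun, List.foldl]
  rw [relMove_dir_of_snd (k := 2) (x := x),
    relMove_dir_of_snd (k := 3) (x := x - Config.dir n 2),
    relMove_dir_of_snd (k := 1) (x := x - Config.dir n 2 - Config.dir n 3),
    relMove_dir_of_snd (k := 1) (x := x - Config.dir n 2 - Config.dir n 3 - Config.dir n 1),
    relMove_dir_of_snd (k := 4) (x := x - Config.dir n 2 - Config.dir n 3 - Config.dir n 1 -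
      Config.dir n 1)] <;>
  simp [Config.dir, h0, h1, h2, h3, Prod.ext_iff]

theorem relRun_pushUp_of_snd {x : Board n} (h0 : x.2 ≠ 0) (h1 : x.2 ≠ 1) :
    relRun (Config.dir n) pushUp x = x - (0, 1) := by
  have h2 : x.2 - 1 ≠ 0 := sub_ne_zero.2 h1
  have h3 : x.2 - 1 ≠ -1 := fun h => h0 (by linear_combination h)
  simp only [relRun, List.foldl]
  rw [relMove_dir_of_snd (k := 3) (x := x),
    relMove_dir_of_snd (k := 2) (x := x - Config.dir n 3),
    relMove_dir_of_snd (k := 4) (x := x - Config.dir n 3 - Config.dir n 2),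
    relMove_dir_of_snd (k := 1) (x := x - Config.dir n 3 - Config.dir n 2 - Config.dir n 4),
    relMove_dir_of_snd (k := 3) (x := x - Config.dir n 3 - Config.dir n 2 - Config.dir n 4 -
      Config.dir n 1)] <;>
  simp [Config.dir, h0, h1, h2, h3, Prod.ext_iff]

theorem relRun_pushUp_of_fst {x : Board n} (h0 : x.1 ≠ 0) (h1 : x.1 ≠ -1) :
    relRun (Config.dir n) pushUp x = x - (0, 1) := by
  have h2 : x.1 + 1 ≠ 0 := fun h => h1 (by linear_combination h)
  have h3 : x.1 + 1 ≠ 1 := fun h => h0 (by linear_combination h)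
  simp only [relRun, List.foldl]
  rw [relMove_dir_of_fst (k := 3) (x := x),
    relMove_dir_of_fst (k := 2) (x := x - Config.dir n 3),
    relMove_dir_of_fst (k := 4) (x := x - Config.dir n 3 - Config.dir n 2),
    relMove_dir_of_fst (k := 1) (x := x - Config.dir n 3 - Config.dir n 2 - Config.dir n 4),
    relMove_dir_of_fst (k := 3) (x := x - Config.dir n 3 - Config.dir n 2 - Config.dir n 4 -
      Config.dir n 1)] <;>
  simp [Config.dir, h0, h1, h2, h3, Prod.ext_iff]

/-- The displacement from the empty square to a piece standing left of it. -/
abbrev leftVec (n : ℕ) : Board n := toBoard n (-1, 0)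

theorem relRun_pushRight_leftVec (hn : 9 ≤ n) :
    relRun (Config.dir n) pushRight (leftVec n) = leftVec n :=
  relRun_toBoard hn _ _ _ (by decide) (by decide)

theorem relRun_pushUp_leftVec (hn : 9 ≤ n) :
    relRun (Config.dir n) pushUp (leftVec n) = leftVec n :=
  relRun_toBoard hn _ _ _ (by decide) (by decide)

/-- The first piece at the origin, the second one at `p`, and the empty square right of the
second one. -/
def besideState (n : ℕ) (p : ℤ × ℤ) : Board n × Board n := (toBoard n (-p.1 - 1, -p.2), leftVec n)

theorem snd_ne_of_mem_gridBox {p : ℤ × ℤ} (hp : p ∈ gridBox (n - 2)) :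
    ((-p.2 : ℤ) : ZMod n) ≠ 0 ∧ ((-p.2 : ℤ) : ZMod n) ≠ 1 := by
  simp only [gridBox, Set.mem_ofPred_eq] at hp
  constructor
  · rw [← Int.cast_zero, ne_eq, intCast_zmod_inj]
    · omega
    · rw [abs_lt]; omega
  · rw [← Int.cast_one, ne_eq, intCast_zmod_inj]
    · omega
    · rw [abs_lt]; omega

theorem injOn_besideState : Set.InjOn (besideState n) (gridBox (n - 2)) := by
  intro p hp q hq h
  simp only [gridBox, Set.mem_ofPred_eq] at hp hq
  simp only [besideState, Prod.mk.injEq, and_true] at h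
  rw [toBoard_inj (by simp only []; rw [abs_lt]; omega) (by simp only []; rw [abs_lt]; omega)] at h
  simp only [Prod.mk.injEq] at h
  ext <;> omega

variable [NeZero n]

local notation "ℰ" => energy (relStep (Config.dir n))

theorem abs_pushRight_sub_le (hn : 9 ≤ n) (f : Board n × Board n → ℝ) {x : Board n} (h0 : x.2 ≠ 0)
    (h1 : x.2 ≠ 1) : |f (x - (1, 0), leftVec n) - f (x, leftVec n)| ≤ 5 * √(ℰ f) := by
  have := abs_relRun_sub_le (Config.dir n) pushRight f x (leftVec n)
  rwa [relRun_pushRight_of_snd h0 h1, relRun_pushRight_leftVec hn] at this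

theorem abs_pushUp_sub_le (hn : 9 ≤ n) (f : Board n × Board n → ℝ) {x : Board n} (h0 : x.1 ≠ 0)
    (h1 : x.1 ≠ -1) : |f (x - (0, 1), leftVec n) - f (x, leftVec n)| ≤ 5 * √(ℰ f) := by
  have := abs_relRun_sub_le (Config.dir n) pushUp f x (leftVec n)
  rwa [relRun_pushUp_of_fst h0 h1, relRun_pushUp_leftVec hn] at this

/-- Pushing one piece around with the empty square at its side embeds a two-dimensional grid into
the chain of two pieces. The rows `0` and `-1` relative to the first piece are left out, so that the
first piece is never moved; each push takes `5` moves, whence the factor `5 ^ 2`. -/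
theorem gridEnergyLE_besideState (hn : 9 ≤ n) (f : Board n × Board n → ℝ) :
    GridEnergyLE (n - 2) (fun p => f (besideState n p)) (25 * ℰ f) := by
  have key : ∀ (w : List (Fin 5)) (u : ℤ × ℤ) (A : Finset (ℤ × ℤ)), w.length = 5 →
      (∀ p ∈ A, p ∈ gridBox (n - 2)) →
      (∀ p ∈ A, besideState n (p + u) = (relRun (Config.dir n) w (besideState n p).1,
        relRun (Config.dir n) w (besideState n p).2)) →
      ∑ p ∈ A, (f (besideState n (p + u)) - f (besideState n p)) ^ 2 ≤ 25 * ℰ f := by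
    intro w u A hw hA hu
    have h := sum_sq_relRun_le (Config.dir n) w f
    rw [hw] at h
    norm_num at h
    refine le_trans ?_ h
    rw [Finset.sum_congr rfl fun p hp => by rw [hu p hp]]
    rw [← Finset.sum_image (f := fun z : Board n × Board n =>
      (f (relRun (Config.dir n) w z.1, relRun (Config.dir n) w z.2) - f z) ^ 2)
      (injOn_besideState.mono fun p hp => hA p hp)]
    exact Finset.sum_le_sum_of_subset_of_nonneg (Finset.subset_univ _) fun _ _ _ => sq_nonneg _
  constructor
  · intro A hA
    refine key pushRight (1, 0) A rfl (fun p hp => (hA p hp).1) fun p hp => ?_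
    obtain ⟨h0, h1⟩ := snd_ne_of_mem_gridBox (hA p hp).1
    simp only [besideState]
    rw [relRun_pushRight_of_snd h0 h1, relRun_pushRight_leftVec hn]
    ext <;> simp [toBoard]; ring
  · intro A hA
    refine key pushUp (0, 1) A rfl (fun p hp => (hA p hp).1) fun p hp => ?_
    obtain ⟨h0, h1⟩ := snd_ne_of_mem_gridBox (hA p hp).1
    simp only [besideState]
    rw [relRun_pushUp_of_snd h0 h1, relRun_pushUp_leftVec hn]
    ext <;> simp [toBoard]; ring

/-- If the second piece is not in row `0` or `-1` relative to the first one, then it is in the box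
up to horizontal translation by `n`, except in two columns, which it leaves when pushed right. -/
theorem exists_besideState_of_snd (hn : 9 ≤ n) (f : Board n × Board n → ℝ) {x : Board n}
    (h0 : x.2 ≠ 0) (h1 : x.2 ≠ 1) :
    ∃ p ∈ gridBox (n - 2), |f (x, leftVec n) - f (besideState n p)| ≤ 10 * √(ℰ f) := by
  have hs := Real.sqrt_nonneg (ℰ f)
  have hj : (((-x.2).val : ℕ) : ZMod n) = -x.2 := ZMod.natCast_rightInverse _
  have hi : (((-1 - x.1).val : ℕ) : ZMod n) = -1 - x.1 := ZMod.natCast_rightInverse _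
  have hjn := ZMod.val_lt (-x.2)
  have hin := ZMod.val_lt (-1 - x.1)
  set j := (-x.2).val
  set i := (-1 - x.1).val
  have hj0 : j ≠ 0 := fun h => h0 (by rw [h] at hj; simpa using hj.symm)
  have hj1 : j ≠ n - 1 := fun h => h1 (by
    rw [h, Nat.cast_sub (by omega)] at hj
    simpa using hj.symm)
  have a1 := abs_pushRight_sub_le hn f h0 h1
  have a2 := abs_pushRight_sub_le hn f (x := x - (1, 0)) (by simpa using h0) (by simpa using h1)
  have b1 := abs_le.1 a1
  have b2 := abs_le.1 a2
  by_cases c : 1 ≤ i ∧ i ≤ n - 2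
  · refine ⟨(i, j), by simp [gridBox]; omega, ?_⟩
    have : besideState n (i, j) = (x, leftVec n) := by
      simp only [besideState, toBoard, Int.cast_sub, Int.cast_neg, Int.cast_natCast, hj, hi]
      ext <;> simp
    rw [this]; simp
  · refine ⟨(1, j), by simp [gridBox]; omega, ?_⟩
    rcases (by omega : i = 0 ∨ i = n - 1) with h | h
    · rw [h] at hi
      have hx : x.1 = -1 := by
        simp only [Nat.cast_zero] at hi
        linear_combination hi
      have : besideState n (1, j) = (x - (1, 0), leftVec n) := by
        simp only [besideState, toBoard, Int.cast_sub, Int.cast_neg, Int.cast_natCast, hj]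
        ext <;> simp [hx]
      rw [this, abs_le]; constructor <;> linarith
    · rw [h, Nat.cast_sub (by omega)] at hi
      have hx : x.1 = 0 := by
        push_cast at hi
        rw [CharP.cast_eq_zero] at hi
        linear_combination hi
      have : besideState n (1, j) = (x - (1, 0) - (1, 0), leftVec n) := by
        simp only [besideState, toBoard, Int.cast_sub, Int.cast_neg, Int.cast_natCast, hj]
        ext <;> simp [hx]
      rw [this, abs_le]; constructor <;> linarith

/-- If the first piece is in the way of pushing the second one up, it is itself moved up first. -/
theorem exists_snd_ne (hn : 9 ≤ n) (f : Board n × Board n → ℝ) {x : Board n} (hx0 : x ≠ 0)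
    (hx1 : x ≠ leftVec n) : ∃ y : Board n, y.2 ≠ 0 ∧ y.2 ≠ 1 ∧
      |f (y, leftVec n) - f (x, leftVec n)| ≤ 10 * √(ℰ f) := by
  have hs := Real.sqrt_nonneg (ℰ f)
  have d1 : (-1 : ZMod n) ≠ 0 := by
    have := intCast_zmod_ne hn (a := -1) (b := 0) (by decide) (by decide); push_cast at this
    exact this
  have d2 : (-1 : ZMod n) ≠ 1 := by
    have := intCast_zmod_ne hn (a := -1) (b := 1) (by decide) (by decide); push_cast at this
    exact this
  have d3 : (2 : ZMod n) ≠ 0 := by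
    have := intCast_zmod_ne hn (a := 2) (b := 0) (by decide) (by decide); push_cast at this
    exact this
  have d4 : (2 : ZMod n) ≠ 1 := by
    have := intCast_zmod_ne hn (a := 2) (b := 1) (by decide) (by decide); push_cast at this
    exact this
  by_cases h0 : x.2 = 0
  · have a0 : x.1 ≠ 0 := fun h => hx0 (Prod.ext h h0)
    have a1 : x.1 ≠ -1 := fun h => hx1 (Prod.ext (by simpa [toBoard] using h) (by
      simp [toBoard, h0]))
    exact ⟨x - (0, 1), by simpa [h0] using d1, by simpa [h0] using d2,
      (abs_pushUp_sub_le hn f a0 a1).trans (by linarith)⟩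
  by_cases h1 : x.2 = 1
  · by_cases a1 : x.1 = -1
    · have e : x = toBoard n (-1, 1) := by ext <;> simp [toBoard, a1, h1]
      have h := abs_relRun_sub_le (Config.dir n) [3, 3, 2, 4, 1, 4] f x (leftVec n)
      rw [e, relRun_toBoard hn _ _ (-1, 2) (by decide) (by decide),
        relRun_toBoard hn _ _ (-1, 0) (by decide) (by decide), ← e] at h
      exact ⟨toBoard n (-1, 2), by simpa [toBoard] using d3, by simpa [toBoard] using d4,
        h.trans (by norm_num; linarith)⟩
    by_cases a0 : x.1 = 0
    · have e : x = toBoard n (0, 1) := by ext <;> simp [toBoard, a0, h1]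
      have h := abs_relRun_sub_le (Config.dir n) [1, 3, 3, 2, 4, 4] f x (leftVec n)
      rw [e, relRun_toBoard hn _ _ (0, 2) (by decide) (by decide),
        relRun_toBoard hn _ _ (-1, 0) (by decide) (by decide), ← e] at h
      exact ⟨toBoard n (0, 2), by simpa [toBoard] using d3, by simpa [toBoard] using d4,
        h.trans (by norm_num; linarith)⟩
    · have b1 := abs_pushUp_sub_le hn f a0 a1
      have b2 := abs_pushUp_sub_le hn f (x := x - (0, 1)) (by simpa using a0) (by simpa using a1)
      refine ⟨x - (0, 1) - (0, 1), by simpa [h1] using d1, by simpa [h1] using d2, ?_⟩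
      rw [abs_le] at b1 b2 ⊢
      constructor <;> linarith
  · exact ⟨x, h0, h1, by simp⟩

/-- From any side of the second piece the empty square can walk round to its right. -/
theorem exists_leftVec_of_adjacent (hn : 9 ≤ n) (f : Board n × Board n → ℝ) {x y : Board n}
    (hx : x ≠ 0) (hy : y ≠ 0) (hxy : x ≠ y) (hk : ∃ k, y = Config.dir n k) :
    ∃ x' : Board n, x' ≠ 0 ∧ x' ≠ leftVec n ∧
      |f (x', leftVec n) - f (x, y)| ≤ 4 * √(ℰ f) := by
  have hs := Real.sqrt_nonneg (ℰ f)
  obtain ⟨w, hw4, hw⟩ : ∃ w : List (Fin 5), w.length ≤ 4 ∧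
      relRun (Config.dir n) w y = leftVec n := by
    obtain ⟨k, rfl⟩ := hk
    rw [← toBoard_intDir]
    fin_cases k
    · exact absurd (by simp [Config.dir]) hy
    · exact ⟨[3, 1, 1, 4], by simp, relRun_toBoard hn _ _ _ (by decide) (by decide)⟩
    · exact ⟨[], by simp, relRun_toBoard hn _ _ _ (by decide) (by decide)⟩
    · exact ⟨[1, 3], by simp, relRun_toBoard hn _ _ _ (by decide) (by decide)⟩
    · exact ⟨[1, 4], by simp, relRun_toBoard hn _ _ _ (by decide) (by decide)⟩
  have h := abs_relRun_sub_le (Config.dir n) w f x y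
  rw [hw] at h
  refine ⟨_, relRun_ne_zero _ w hx, fun e => hxy (relRun_injective _ w (e.trans hw.symm)),
    h.trans ?_⟩
  have : (w.length : ℝ) ≤ 4 := by exact_mod_cast hw4
  gcongr

/-- The target: the first piece left of the empty square, the second one above it. -/
def cornerState (n : ℕ) : Board n × Board n := (toBoard n (-1, 0), toBoard n (0, 1))

/-- Whenever the empty square is next to the second piece, the resistance to the target position is
`O(log n)`. -/
theorem abs_sub_cornerState_le (hn : 9 ≤ n) (f : Board n × Board n → ℝ) {x y : Board n}
    (hx : x ≠ 0) (hy : y ≠ 0) (hxy : x ≠ y) (hk : ∃ k, y = Config.dir n k) :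
    |f (x, y) - f (cornerState n)| ≤ 100 * √(Real.log n * ℰ f) := by
  obtain ⟨x₁, h10, h11, h1⟩ := exists_leftVec_of_adjacent hn f hx hy hxy hk
  obtain ⟨x₂, h20, h21, h2⟩ := exists_snd_ne hn f h10 h11
  obtain ⟨⟨p, q⟩, hp, h3⟩ := exists_besideState_of_snd hn f h20 h21
  have h4 := (gridEnergyLE_besideState hn f).corner p q hp
  have h5 := abs_relRun_sub_le (Config.dir n) [4, 2] f (toBoard n (-2, -1)) (toBoard n (-1, 0))
  rw [relRun_toBoard hn _ _ (-1, 0) (by decide) (by decide),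
    relRun_toBoard hn _ _ (0, 1) (by decide) (by decide)] at h5
  have e5 : besideState n (1, 1) = (toBoard n (-2, -1), toBoard n (-1, 0)) := by
    simp [besideState, toBoard]
  simp only [e5] at h4
  have hE := energy_nonneg (relStep (Config.dir n)) f
  have hlog1 : 1 ≤ Real.log n := by
    rw [Real.le_log_iff_exp_le (by positivity)]
    exact Real.exp_one_lt_three.le.trans (by exact_mod_cast (by omega : 3 ≤ n))
  have hlogm : Real.log ((n : ℤ) - 2 : ℤ) ≤ Real.log n := by
    apply Real.log_le_log
    · push_cast
      have : (9 : ℝ) ≤ n := by exact_mod_cast hn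
      linarith
    · push_cast; linarith
  have t1 : √(ℰ f) ≤ √(Real.log n * ℰ f) := Real.sqrt_le_sqrt (le_mul_of_one_le_left hE hlog1)
  have t2 : √(25 * ℰ f) = 5 * √(ℰ f) := by
    rw [Real.sqrt_mul (by norm_num), show (25 : ℝ) = 5 ^ 2 by norm_num,
      Real.sqrt_sq (by norm_num)]
  have t3 : √((1 + Real.log ((n : ℤ) - 2 : ℤ)) * (2 * (25 * ℰ f))) ≤
      10 * √(Real.log n * ℰ f) := by
    rw [← Real.sqrt_sq (by norm_num : (0 : ℝ) ≤ 10), ← Real.sqrt_mul (by norm_num)]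
    apply Real.sqrt_le_sqrt
    nlinarith [mul_le_mul_of_nonneg_right hlogm hE, mul_le_mul_of_nonneg_right hlog1 hE]
  rw [t2] at h4
  simp only [List.length_cons, List.length_nil] at h5
  push_cast at h5
  have e : f (cornerState n) = f (toBoard n (-1, 0), toBoard n (0, 1)) := rfl
  rw [e]
  rw [abs_le] at *
  constructor <;> linarith

/-- The empty square and two pieces reach the target position in expected time
`O(n ^ 4 log n)`. -/
theorem exists_expected_hitting_cornerState (hn : 9 ≤ n) :
    ∃ H : Board n × Board n → ℝ, (∀ z, 0 ≤ H z) ∧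
      (∀ z, H z ≤ 100160 * (n : ℝ) ^ 4 * Real.log n) ∧
      ∀ z : Board n × Board n, z.1 ≠ 0 → z.2 ≠ 0 → z.1 ≠ z.2 → z ≠ cornerState n →
        1 + stepMean (relStep (Config.dir n)) H z ≤ H z := by
  set φ := relStep (Config.dir n) with hφ
  have hlog1 : 1 ≤ Real.log n := by
    rw [Real.le_log_iff_exp_le (by positivity)]
    exact Real.exp_one_lt_three.le.trans (by exact_mod_cast (by omega : 3 ≤ n))
  obtain ⟨ℓ, ℓ0, ℓA, ℓP⟩ := exists_expected_hitting_zero (fun k => -Config.dir n k) 2 4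
    (by simp [Config.dir]) (by simp [Config.dir])
  set T : Set (Board n × Board n) :=
    {z | ¬ (z.1 ≠ 0 ∧ z.2 ≠ 0 ∧ z.1 ≠ z.2 ∧ z ≠ cornerState n)} with hTdef
  obtain ⟨H, H0, HA, -, HP⟩ := exists_expected_hitting T (stepMean φ)
    (stepMean_mono φ) (continuous_stepMean φ) (by rw [stepMean_zero])
    (100160 * (n : ℝ) ^ 4 * Real.log n) (by
      intro h h0 hT hP
      have hE := energy_le_of_subsolution φ (relStep_bijective _) T h h0 hT hP
      obtain ⟨m, hm⟩ := Finite.exists_max h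
      have hsum : ∑ z, h z ≤ (n : ℝ) ^ 4 * h m := by
        calc ∑ z, h z ≤ ∑ _z : Board n × Board n, h m := Finset.sum_le_sum fun z _ => hm z
          _ = (n : ℝ) ^ 4 * h m := by
            rw [Finset.sum_const, Finset.card_univ, nsmul_eq_mul]
            simp only [Fintype.card_prod, ZMod.card]
            push_cast
            ring
      have hcT : cornerState n ∈ T := by simp [hTdef]
      have hadj : ∀ z ∈ T ∪ {z | ∃ k, z.2 = Config.dir n k},
          h z ≤ 100 * √(Real.log n * energy φ h) := by
        intro z hz
        by_cases hzT : z ∈ T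
        · rw [hT z hzT]; positivity
        · have hk : ∃ k, z.2 = Config.dir n k := hz.resolve_left hzT
          simp only [hTdef, Set.mem_ofPred_eq, not_not] at hzT
          have := abs_sub_cornerState_le hn h hzT.1 hzT.2.1 hzT.2.2.1 hk
          rw [hT _ hcT, sub_zero] at this
          exact (le_abs_self _).trans this
      -- until the empty square is next to the second piece it performs a simple random walk
      have hcomp := le_of_subsolution_of_supersolution φ Set.univ
        (T ∪ {z | ∃ k, z.2 = Config.dir n k}) (fun _ _ _ _ => trivial) h (fun z => ℓ z.2)
        (100 * √(Real.log n * energy φ h)) (fun z => ℓ0 _)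
        (fun z _ hz => hP z fun h' => hz (Or.inl h'))
        (fun z _ hz => by
          simp only [Set.mem_union, not_or] at hz
          obtain ⟨hzT, hk⟩ := hz
          simp only [hTdef, Set.mem_ofPred_eq, not_not] at hzT
          simp only [Set.mem_ofPred_eq, not_exists] at hk
          refine le_of_eq_of_le ?_ (ℓP z.2 hzT.2.1)
          congr 1
          unfold stepMean
          congr 1
          refine Finset.sum_congr rfl fun k _ => ?_
          simp only [hφ, relStep]
          rw [relMove_of_ne hzT.2.1 (hk k), sub_eq_add_neg])
        (fun z _ hz => hadj z hz) m trivial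
      have hℓ := ℓA m.2
      simp only [Fintype.card_fin] at hℓ hE
      push_cast at hℓ hE
      have hn4 : (0 : ℝ) ≤ (n : ℝ) ^ 4 := by positivity
      have hm0 : 0 ≤ h m := h0 m
      -- the arithmetic-geometric mean inequality absorbs the maximum of `h`
      have hsq : 100 * √(Real.log n * energy φ h) ≤
          50000 * (n : ℝ) ^ 4 * Real.log n + h m / 2 := by
        have hE2 : Real.log n * energy φ h ≤ Real.log n * (10 * ((n : ℝ) ^ 4 * h m)) := by
          refine mul_le_mul_of_nonneg_left ?_ (by linarith)
          linarith
        refine (mul_le_mul_of_nonneg_left (Real.sqrt_le_sqrt hE2) (by norm_num)).trans ?_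
        set X := (n : ℝ) ^ 4 * Real.log n with hX
        have hX0 : 0 ≤ X := by positivity
        have e1 : Real.log n * (10 * ((n : ℝ) ^ 4 * h m)) = 10 * X * h m := by rw [hX]; ring
        rw [e1]
        have e2 : √(10 * X * h m) ≤ 500 * X + h m / 200 := by
          apply Real.sqrt_le_iff.2 ⟨by positivity, ?_⟩
          nlinarith [sq_nonneg (500 * X - h m / 200)]
        rw [mul_assoc 50000, ← hX]
        linarith
      intro z
      have := hm z
      nlinarith [mul_le_mul_of_nonneg_left hlog1 hn4])
  refine ⟨H, H0, HA, fun z h1 h2 h3 h4 => (HP z ?_).ge⟩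
  simp only [hTdef, Set.mem_ofPred_eq, not_not]
  exact ⟨h1, h2, h3, h4⟩

end TwoPieces

/-! ### Local rearrangements of the pieces -/

section Words

variable {n : ℕ} {ι : Type}

namespace Config

theorem move_apply (v : Board n) (s : Config n ι) (i : Option ι) :
    move v s i = Equiv.swap (s none) (s none + v) (s i) := rfl

theorem move_none (v : Board n) (s : Config n ι) : move v s none = s none + v := by
  rw [move_apply, Equiv.swap_apply_left]

@[ext]
theorem ext {s t : Config n ι} (h : ∀ i, s i = t i) : s = t := DFunLike.ext _ _ h

theorem injective (s : Config n ι) : Function.Injective s := Function.Embedding.injective s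

theorem move_zero (s : Config n ι) : move 0 s = s := by
  ext i : 1
  rw [move_apply, add_zero, Equiv.swap_self, Equiv.refl_apply]

/-- The position after a sequence of moves of the empty square. -/
def run (w : List (Fin 5)) (s : Config n ι) : Config n ι :=
  w.foldl (fun s k => move (dir n k) s) s

theorem run_cons (k : Fin 5) (w : List (Fin 5)) (s : Config n ι) :
    run (k :: w) s = run w (move (dir n k) s) := rfl

theorem run_replicate_zero (L : ℕ) (s : Config n ι) : run (List.replicate L 0) s = s := by
  induction L with
  | zero => rfl
  | succ L ih =>
    rw [List.replicate_succ, run_cons]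
    have : dir n 0 = 0 := rfl
    rw [this, move_zero, ih]

end Config

open Equiv Config

/-- `SlideBy L σ e e'`: some sequence of `L` moves takes the empty square from `e` to `e'` and
permutes the contents of the board by `σ`. -/
inductive SlideBy : ℕ → Perm (Board n) → Board n → Board n → Prop
  | nil (e : Board n) : SlideBy 0 1 e e
  | cons {L : ℕ} {σ : Perm (Board n)} {e e' : Board n} (k : Fin 5)
      (h : SlideBy L σ (e + dir n k) e') : SlideBy (L + 1) (σ * swap e (e + dir n k)) e e'

namespace SlideBy

theorem single (k : Fin 5) (e : Board n) : SlideBy 1 (swap e (e + dir n k)) e (e + dir n k) := by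
  simpa using SlideBy.cons k (SlideBy.nil (e + dir n k))

theorem trans {L L' : ℕ} {σ τ : Perm (Board n)} {e e' e'' : Board n} (h : SlideBy L σ e e')
    (h' : SlideBy L' τ e' e'') : SlideBy (L + L') (τ * σ) e e'' := by
  induction h with
  | nil e => simpa using h'
  | cons k _ ih =>
    have := SlideBy.cons k (ih h')
    rwa [mul_assoc, add_right_comm] at this

theorem symm {L : ℕ} {σ : Perm (Board n)} {e e' : Board n} (h : SlideBy L σ e e') :
    SlideBy L σ⁻¹ e' e := by
  induction h with
  | nil e => exact SlideBy.nil e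
  | @cons L σ e e' k _ ih =>
    obtain ⟨k', hk⟩ : ∃ k', dir n k' = -dir n k := by
      fin_cases k
      · exact ⟨0, by simp [dir]⟩
      · exact ⟨2, by simp [dir]⟩
      · exact ⟨1, by simp [dir]⟩
      · exact ⟨4, by simp [dir]⟩
      · exact ⟨3, by simp [dir]⟩
    have h1 := single k' (e + dir n k)
    rw [hk, add_neg_cancel_right, swap_comm] at h1
    simpa using ih.trans h1

theorem exists_run {L : ℕ} {σ : Perm (Board n)} {e e' : Board n} (h : SlideBy L σ e e') :
    ∃ w : List (Fin 5), w.length = L ∧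
      ∀ s : Config n ι, s none = e → ∀ i, run w s i = σ (s i) := by
  induction h with
  | nil e => exact ⟨[], rfl, fun s _ i => rfl⟩
  | cons k _ ih =>
    obtain ⟨w, hw, hr⟩ := ih
    refine ⟨k :: w, by simp [hw], fun s hs i => ?_⟩
    rw [run_cons, hr _ (by rw [move_none, hs]), move_apply, hs]
    rfl

end SlideBy

/-- `σ` moves `p` to `q`, `q` to `r` and `r` to `p`, and fixes everything else. -/
structure IsCycleOn₃ {X : Type} (σ : Perm X) (p q r : X) : Prop where
  fst : σ p = q
  snd : σ q = r
  thd : σ r = p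
  other : ∀ z, z ≠ p → z ≠ q → z ≠ r → σ z = z

theorem IsCycleOn₃.conj {X : Type} {σ : Perm X} {p q r : X} (h : IsCycleOn₃ σ p q r) (c : Perm X) :
    IsCycleOn₃ (c * σ * c⁻¹) (c p) (c q) (c r) where
  fst := by simp [h.fst]
  snd := by simp [h.snd]
  thd := by simp [h.thd]
  other z hp hq hr := by
    simp only [Perm.mul_apply]
    rw [h.other]
    · simp
    · rwa [ne_eq, Perm.inv_eq_iff_eq]
    · rwa [ne_eq, Perm.inv_eq_iff_eq]
    · rwa [ne_eq, Perm.inv_eq_iff_eq]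

/-- The square at displacement `(-i, j)` from `e`. -/
def cell (e : Board n) (i j : ℕ) : Board n := e + toBoard n (-i, j)

theorem cell_inj (e : Board n) {i j i' j' : ℕ} (hi : i < n) (hi' : i' < n) (hj : j < n)
    (hj' : j' < n) : cell e i j = cell e i' j' ↔ i = i' ∧ j = j' := by
  rw [cell, cell, add_right_inj, toBoard_inj]
  · simp
  · simp only []; rw [abs_lt]; omega
  · simp only []; rw [abs_lt]; omega

theorem cell_ne (e : Board n) {i j i' j' : ℕ}
    (h : i < n ∧ i' < n ∧ j < n ∧ j' < n ∧ ¬ (i = i' ∧ j = j')) : cell e i j ≠ cell e i' j' :=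
  (cell_inj e h.1 h.2.1 h.2.2.1 h.2.2.2.1).not.2 h.2.2.2.2

theorem cell_zero (e : Board n) : cell e 0 0 = e := by simp [cell, toBoard]

theorem cell_add_left (e : Board n) (i j : ℕ) : cell e i j + dir n 2 = cell e (i + 1) j := by
  ext <;> simp [cell, toBoard, dir]; ring

theorem cell_add_right (e : Board n) (i j : ℕ) : cell e (i + 1) j + dir n 1 = cell e i j := by
  ext <;> simp [cell, toBoard, dir]; ring

theorem cell_add_up (e : Board n) (i j : ℕ) : cell e i j + dir n 3 = cell e i (j + 1) := by
  ext <;> simp [cell, toBoard, dir]; ring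

theorem cell_add_down (e : Board n) (i j : ℕ) : cell e i (j + 1) + dir n 4 = cell e i j := by
  ext <;> simp [cell, toBoard, dir]; ring

theorem exists_slideBy_left (e : Board n) (k : ℕ) : ∃ σ : Perm (Board n),
    SlideBy k σ e (cell e k 0) ∧ ∀ p, (∀ i ≤ k, p ≠ cell e i 0) → σ p = p := by
  induction k with
  | zero => exact ⟨1, by rw [cell_zero]; exact SlideBy.nil e, fun _ _ => rfl⟩
  | succ k ih =>
    obtain ⟨σ, h, hσ⟩ := ih
    have h1 := h.trans (SlideBy.single 2 (cell e k 0))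
    rw [cell_add_left] at h1
    refine ⟨_, h1, fun p hp => ?_⟩
    rw [Perm.mul_apply, hσ p fun i hi => hp i (by omega),
      swap_apply_of_ne_of_ne (hp k (by omega)) (hp (k + 1) le_rfl)]

/-- The empty square walks once round a `2 × 2` block. -/
theorem exists_slideBy_loop (e : Board n) (k : ℕ) (hk : k + 2 < n) : ∃ σ : Perm (Board n),
    SlideBy 4 σ (cell e k 0) (cell e k 0) ∧
      IsCycleOn₃ σ (cell e (k + 1) 0) (cell e k 1) (cell e (k + 1) 1) := by
  have h := (((SlideBy.single 2 (cell e k 0)).trans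
    (SlideBy.single 3 (cell e k 0 + dir n 2))).trans
      (SlideBy.single 1 (cell e k 0 + dir n 2 + dir n 3))).trans
        (SlideBy.single 4 (cell e k 0 + dir n 2 + dir n 3 + dir n 1))
  rw [cell_add_left, cell_add_up, cell_add_right, cell_add_down] at h
  have n1 : cell e k 0 ≠ cell e (k + 1) 0 := cell_ne e (by omega)
  have n2 : cell e k 0 ≠ cell e k 1 := cell_ne e (by omega)
  have n3 : cell e k 0 ≠ cell e (k + 1) 1 := cell_ne e (by omega)
  have n4 : cell e (k + 1) 0 ≠ cell e k 1 := cell_ne e (by omega)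
  have n5 : cell e (k + 1) 0 ≠ cell e (k + 1) 1 :=
    cell_ne e (by omega)
  have n6 : cell e k 1 ≠ cell e (k + 1) 1 := cell_ne e (by omega)
  simp only [Nat.zero_add] at h
  refine ⟨_, h, ?_, ?_, ?_, ?_⟩
  · simp [Perm.mul_apply, swap_apply_def, n1, n2, n3]
  · simp [Perm.mul_apply, swap_apply_def, n6, n2.symm, n3.symm, n4.symm, n6.symm]
  · simp [Perm.mul_apply, swap_apply_def, n4, n5, n3.symm, n5.symm, n1.symm]
  · intro z h1 h2 h3
    by_cases h0 : z = cell e k 0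
    · simp [Perm.mul_apply, h0]
    · simp [Perm.mul_apply, swap_apply_def, h0, h1, h2, h3]

/-- The empty square walks left, once round a `2 × 2` block and back. -/
theorem exists_slideBy_far_loop (e : Board n) (k : ℕ) (hk : k + 2 < n) : ∃ σ : Perm (Board n),
    SlideBy (2 * k + 4) σ e e ∧
      IsCycleOn₃ σ (cell e (k + 1) 0) (cell e k 1) (cell e (k + 1) 1) := by
  obtain ⟨τ, hτ, hτ'⟩ := exists_slideBy_left e k
  obtain ⟨σ, hσ, hσ'⟩ := exists_slideBy_loop e k hk
  refine ⟨τ⁻¹ * σ * τ⁻¹⁻¹, ?_, ?_⟩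
  · have := (hτ.trans hσ).trans hτ.symm
    rw [inv_inv, mul_assoc]
    convert this using 1
    ring
  · have h1 : τ⁻¹ (cell e (k + 1) 0) = cell e (k + 1) 0 :=
      Perm.inv_eq_iff_eq.2 (hτ' _ fun i hi =>
        cell_ne e (by omega)).symm
    have h2 : τ⁻¹ (cell e k 1) = cell e k 1 :=
      Perm.inv_eq_iff_eq.2 (hτ' _ fun i hi =>
        cell_ne e (by omega)).symm
    have h3 : τ⁻¹ (cell e (k + 1) 1) = cell e (k + 1) 1 :=
      Perm.inv_eq_iff_eq.2 (hτ' _ fun i hi =>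
        cell_ne e (by omega)).symm
    have := hσ'.conj τ⁻¹
    rwa [h1, h2, h3] at this

/-- Conjugating the walk round the block at the empty square by the far loops replaces the third
square of its cycle by any square of the row above. -/
theorem exists_slideBy_cycle (e : Board n) (k : ℕ) (hk : k + 2 < n) : ∃ L ≤ 2 * (k + 1) ^ 2 +
    6 * (k + 1), ∃ σ : Perm (Board n), SlideBy L σ e e ∧
      IsCycleOn₃ σ (cell e 1 0) (cell e 0 1) (cell e (k + 1) 1) := by
  induction k with
  | zero =>
    obtain ⟨σ, h, h'⟩ := exists_slideBy_far_loop e 0 (by omega)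
    exact ⟨4, by omega, σ, h, h'⟩
  | succ k ih =>
    obtain ⟨L, hL, σ, h, h'⟩ := ih (by omega)
    obtain ⟨c, hc, hc'⟩ := exists_slideBy_far_loop e (k + 1) hk
    refine ⟨_, ?_, _, (hc.symm.trans h).trans hc, ?_⟩
    · nlinarith
    · have := h'.conj c
      rw [hc'.snd, hc'.other (cell e 1 0), hc'.other (cell e 0 1), mul_assoc] at this
      · exact this
      all_goals exact cell_ne e (by omega)

/-- With a piece `j` left of the empty square in `s` and above it in `t`, a bounded number of moves
of `s` brings it to the right place without disturbing the pieces that already agree. -/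
theorem exists_run_match {d : ℕ} (hn : d + 2 < n) (s t : Config n (Fin d)) (j : Fin d)
    (h0 : s none = t none) (hm : ∀ i < j, s (some i) = t (some i))
    (hs : s (some j) = cell (s none) 1 0) (ht : t (some j) = cell (s none) 0 1) :
    ∃ w : List (Fin 5), w.length ≤ 2 * d ^ 2 + 6 * d ∧ run w s none = t none ∧
      ∀ i ≤ j, run w s (some i) = t (some i) := by
  set e := s none with he
  -- fewer than `d` pieces have a label below `j`, so one of `d` squares holds none of them
  obtain ⟨k, hk⟩ : ∃ k : Fin d, ∀ i < j, s (some i) ≠ cell e (k + 1) 1 := by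
    by_contra! hcon
    choose g hg1 hg2 using hcon
    have hinj : g.Injective := by
      intro a b hab
      have := hg2 a
      rw [hab, hg2 b, cell_inj] at this <;> omega
    obtain ⟨a, ha⟩ := Finite.surjective_of_injective hinj j
    exact absurd (hg1 a) (by rw [ha]; exact lt_irrefl j)
  obtain ⟨L, hL, σ, h, h'⟩ := exists_slideBy_cycle e k (by omega)
  obtain ⟨w, hw, hr⟩ := h.exists_run (ι := Fin d)
  refine ⟨w, ?_, ?_, fun i hi => ?_⟩
  · rw [hw]
    have : (k : ℕ) + 1 ≤ d := k.2
    exact hL.trans (by gcongr)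
  · rw [hr s rfl, ← he, h'.other, h0]
    all_goals
      nth_rewrite 1 [← cell_zero e]
      rw [ne_eq, cell_inj] <;> omega
  · rw [hr s rfl]
    rcases hi.eq_or_lt with rfl | hi
    · rw [hs, h'.fst, ht]
    · rw [h'.other, hm i hi]
      · rw [← hs]
        exact fun h => hi.ne (Option.some_injective _ (s.injective h))
      · rw [← ht, hm i hi]
        exact fun h => hi.ne (Option.some_injective _ (t.injective h))
      · exact hk i hi

end Words

/-! ### Bounding the cost of the optimal strategy -/

section Coupling

open Config

variable {n d : ℕ}

/-- Both copies make the same move. -/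
def identicalMove (n d : ℕ) (k : Fin 5) (z : Config n (Fin d) × Config n (Fin d)) :
    Config n (Fin d) × Config n (Fin d) := (move (dir n k) z.1, move (dir n k) z.2)

/-- The two copies move independently. -/
def independentMove (n d : ℕ) (k : Fin 5 × Fin 5) (z : Config n (Fin d) × Config n (Fin d)) :
    Config n (Fin d) × Config n (Fin d) := (move (dir n k.1) z.1, move (dir n k.2) z.2)

/-- The empty squares agree, and so do the pieces with labels below `j`. -/
def agreeBelow (n d j : ℕ) : Set (Config n (Fin d) × Config n (Fin d)) :=
  {z | z.1 none = z.2 none ∧ ∀ i : Fin d, (i : ℕ) < j → z.1 (some i) = z.2 (some i)}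

theorem eq_of_mem_agreeBelow {z : Config n (Fin d) × Config n (Fin d)}
    (h : z ∈ agreeBelow n d d) : z.1 = z.2 := by
  ext i : 1
  cases i with
  | none => exact h.1
  | some i => exact h.2 i i.2

theorem identicalMove_mem_agreeBelow {j : ℕ} {z : Config n (Fin d) × Config n (Fin d)}
    (h : z ∈ agreeBelow n d j) (k : Fin 5) : identicalMove n d k z ∈ agreeBelow n d j := by
  obtain ⟨h0, h1⟩ := h
  refine ⟨?_, fun i hi => ?_⟩
  · simp only [identicalMove, move_none, h0]
  · simp only [identicalMove, move_apply, h0, h1 i hi]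

theorem move_sub (v : Board n) (s : Config n (Fin d)) (i : Option (Fin d)) :
    move v s i - move v s none = relMove v (s i - s none) := by
  rw [move_none, move_apply, relMove]
  rw [Equiv.swap_apply_def, Equiv.swap_apply_def]
  simp only [sub_eq_iff_eq_add', add_zero]
  split_ifs <;> simp [sub_sub]

theorem finite_config [NeZero n] : Finite (Config n (Fin d)) :=
  Finite.of_injective (fun s : Config n (Fin d) => (s : Option (Fin d) → Board n))
    DFunLike.coe_injective

/-- Two prescribed sequences of `L` moves are followed by independent copies with probability
`25⁻ᴸ`. -/
theorem le_of_independent_run (W : Config n (Fin d) × Config n (Fin d) → ℝ) (M : ℝ)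
    (hM : ∀ z, W z ≤ M) (hJ : ∀ z, W z ≤ 1 + stepMean (independentMove n d) W z)
    (w w' : List (Fin 5)) (hw : w.length = w'.length) (s t : Config n (Fin d)) :
    W (s, t) ≤ w.length + (1 - (1 / 25) ^ w.length) * M +
      (1 / 25) ^ w.length * W (run w s, run w' t) := by
  induction w generalizing w' s t with
  | nil =>
    obtain rfl : w' = [] := List.length_eq_zero_iff.1 hw.symm
    simp [run]
  | cons k w ih =>
    cases w' with
    | nil => simp at hw
    | cons k' w' =>
      have h := ih w' (by simpa using hw) (move (dir n k) s) (move (dir n k') t)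
      have hJ := hJ (s, t)
      have h1 : stepMean (independentMove n d) W (s, t) ≤
          (24 * M + W (move (dir n k) s, move (dir n k') t)) / 25 := by
        unfold stepMean
        simp only [Fintype.card_prod, Fintype.card_fin]
        push_cast
        refine div_le_div_of_nonneg_right ?_ (by norm_num)
        rw [← Finset.sum_erase_add _ _ (Finset.mem_univ (k, k'))]
        refine add_le_add ?_ le_rfl
        refine (Finset.sum_le_sum fun i _ => hM _).trans_eq ?_
        simp [Finset.card_erase_of_mem]
      rw [run_cons, run_cons, List.length_cons, pow_succ]
      push_cast
      set q : ℝ := (1 / 25) ^ w.length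
      set V := W (run w (move (dir n k) s), run w' (move (dir n k') t))
      have hL : (0 : ℝ) ≤ w.length := by positivity
      linarith

/-- The number of moves allowed for a local rearrangement. -/
def localLength (d : ℕ) : ℕ := 2 * d ^ 2 + 6 * d

/-- The constant for matching the first `j` pieces. -/
noncomputable def matchConst (d : ℕ) : ℕ → ℝ
  | 0 => 1
  | j + 1 => (matchConst d j + 1) * 25 ^ localLength d

/-- If the pieces below `j` agree, identical moves bring the two copies of piece `j` next to the
empty square and to each other, and then independent moves match them with a probability bounded
below. The minimum covers the case that `m` exceeds the global bound `M`. -/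
theorem le_of_mem_agreeBelow [NeZero n] (hn : 9 ≤ n) (hnd : d + 2 < n)
    (W : Config n (Fin d) × Config n (Fin d) → ℝ) (M : ℝ) (hM : ∀ z, W z ≤ M)
    (hI : ∀ z, W z ≤ 1 + stepMean (identicalMove n d) W z)
    (hJ : ∀ z, W z ≤ 1 + stepMean (independentMove n d) W z)
    (j : Fin d) (m : ℝ) (hm : ∀ z ∈ agreeBelow n d (j + 1), W z ≤ m) :
    ∀ z ∈ agreeBelow n d j, W z ≤ 200320 * (n : ℝ) ^ 4 * Real.log n + localLength d +
      (1 - (1 / 25) ^ localLength d) * M + (1 / 25) ^ localLength d * min m M := by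
  have := finite_config (n := n) (d := d)
  set p : ℝ := (1 / 25) ^ localLength d with hp
  have hp0 : 0 < p := by positivity
  have hp1 : p ≤ 1 := pow_le_one₀ (by norm_num) (by norm_num)
  obtain ⟨H, H0, HA, HP⟩ := exists_expected_hitting_cornerState hn
  let ρ : Config n (Fin d) × Config n (Fin d) → Board n × Board n := fun z =>
    (z.1 (some j) - z.1 none, z.2 (some j) - z.2 none)
  set T : Set (Config n (Fin d) × Config n (Fin d)) :=
    {z | ρ z = cornerState n ∨ z.1 (some j) = z.2 (some j)} with hT
  have key : ∀ z ∈ agreeBelow n d j, z ∈ T → W z ≤ localLength d + (1 - p) * M + p * min m M := by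
    rintro ⟨s, t⟩ hz hzT
    -- the relative chain needs the two copies of piece `j` on distinct squares
    by_cases hj : s (some j) = t (some j)
    · have h1 : W (s, t) ≤ m := hm _ ⟨hz.1, fun i hi => by
        rcases (Nat.lt_succ_iff.1 hi).lt_or_eq with hi | hi
        · exact hz.2 i hi
        · rw [Fin.ext hi]; exact hj⟩
      have h2 : W (s, t) ≤ min m M := le_min h1 (hM _)
      have h3 : (0 : ℝ) ≤ localLength d := by positivity
      nlinarith [hM (s, t), mul_le_mul_of_nonneg_left h2 hp0.le,
        mul_le_mul_of_nonneg_left (hM (s, t)) (by linarith : 0 ≤ 1 - p)]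
    · have hρ : ρ (s, t) = cornerState n := hzT.resolve_right hj
      obtain ⟨h0, hlt⟩ := hz
      simp only at h0 hlt
      simp only [ρ, cornerState, Prod.mk.injEq, sub_eq_iff_eq_add'] at hρ
      obtain ⟨w, hw, hw0, hwj⟩ := exists_run_match hnd s t j h0 (fun i hi => hlt i hi)
        (by rw [hρ.1]; simp [cell]) (by rw [hρ.2, ← h0]; simp [cell])
      have h1 := le_of_independent_run W M hM hJ w (List.replicate w.length 0) (by simp) s t
      rw [run_replicate_zero] at h1
      have h2 : W (run w s, t) ≤ min m M :=
        le_min (hm _ ⟨hw0, fun i hi => hwj i (Nat.lt_succ_iff.1 hi)⟩) (hM _)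
      have h3 : (w.length : ℝ) ≤ localLength d := by exact_mod_cast hw
      have h4 : p ≤ (1 / 25) ^ w.length := pow_le_pow_of_le_one (by norm_num) (by norm_num) hw
      have h5 : W (run w s, t) ≤ M := hM _
      have h6 : (0 : ℝ) ≤ (1 / 25) ^ w.length := by positivity
      set q : ℝ := (1 / 25) ^ w.length
      nlinarith [mul_le_mul_of_nonneg_left h2 h6,
        mul_nonneg (sub_nonneg.2 h4) (sub_nonneg.2 (min_le_right m M))]
  intro z hz
  have h := le_of_subsolution_of_supersolution (identicalMove n d) (agreeBelow n d j) T
    (fun z hz _ k => identicalMove_mem_agreeBelow hz k) W (fun z => H (ρ z))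
    (localLength d + (1 - p) * M + p * min m M) (fun z => H0 _) (fun z _ _ => hI z)
    (fun z hz hzT => by
      have hρk : ∀ k, ρ (identicalMove n d k z) = relStep (dir n) k (ρ z) := fun k => by
        simp only [ρ, identicalMove, move_sub, relStep]
      have hs : stepMean (identicalMove n d) (fun z => H (ρ z)) z =
          stepMean (relStep (dir n)) H (ρ z) := by
        unfold stepMean
        simp only [hρk]
      rw [hs]
      simp only [hT, Set.mem_ofPred_eq, not_or] at hzT
      refine HP (ρ z) ?_ ?_ ?_ hzT.1
      · simp only [ρ]
        exact sub_ne_zero.2 (z.1.injective.ne (by simp))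
      · simp only [ρ]
        exact sub_ne_zero.2 (z.2.injective.ne (by simp))
      · simp only [ρ]
        rw [hz.1, ne_eq, sub_left_inj]
        exact hzT.2)
    key z hz
  linarith [HA (ρ z)]

/-- Whatever the start, independent moves bring the two empty squares together. -/
theorem le_of_agree_empty [NeZero n] (W : Config n (Fin d) × Config n (Fin d) → ℝ)
    (hJ : ∀ z, W z ≤ 1 + stepMean (independentMove n d) W z)
    (m : ℝ) (hm : ∀ z ∈ agreeBelow n d 0, W z ≤ m) (z : Config n (Fin d) × Config n (Fin d)) :
    W z ≤ 400 * (n : ℝ) ^ 4 + m := by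
  have := finite_config (n := n) (d := d)
  obtain ⟨H, H0, HA, HP⟩ := exists_expected_hitting_zero
    (fun k : Fin 5 × Fin 5 => dir n k.1 - dir n k.2) (1, 0) (3, 0) (by simp [dir]) (by simp [dir])
  have h := le_of_subsolution_of_supersolution (independentMove n d) Set.univ (agreeBelow n d 0)
    (fun _ _ _ _ => trivial) W (fun z => H (z.1 none - z.2 none)) m (fun z => H0 _)
    (fun z _ _ => hJ z)
    (fun z _ hz => by
      have hne : z.1 none - z.2 none ≠ 0 := fun h0 =>
        hz ⟨sub_eq_zero.1 h0, fun i hi => absurd hi (Nat.not_lt_zero _)⟩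
      refine le_of_eq_of_le ?_ (HP _ hne)
      unfold stepMean
      simp only [independentMove, move_none, add_sub_add_comm])
    (fun z _ hz => hm z hz) z trivial
  have := HA (z.1 none - z.2 none)
  simp only [Fintype.card_prod, Fintype.card_fin] at this
  push_cast at this
  linarith

/-- Every function that is a subsolution for both kinds of moves and vanishes on the diagonal is
`O(n ^ 4 log n)`. -/
theorem le_of_subsolution [NeZero n] (hn : 9 ≤ n) (hnd : d + 2 < n) (hnl : localLength d ≤ n)
    (W : Config n (Fin d) × Config n (Fin d) → ℝ)
    (hdiag : ∀ z, z.1 = z.2 → W z = 0)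
    (hI : ∀ z, W z ≤ 1 + stepMean (identicalMove n d) W z)
    (hJ : ∀ z, W z ≤ 1 + stepMean (independentMove n d) W z)
    (z : Config n (Fin d) × Config n (Fin d)) :
    W z ≤ matchConst d d * (300000 * (n : ℝ) ^ 4 * Real.log n) := by
  have := finite_config (n := n) (d := d)
  have : Nonempty (Config n (Fin d) × Config n (Fin d)) := ⟨z⟩
  obtain ⟨z₀, hz₀⟩ := Finite.exists_max W
  set M := W z₀ with hMdef
  set A := 300000 * (n : ℝ) ^ 4 * Real.log n with hA
  have hlog1 : 1 ≤ Real.log n := by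
    rw [Real.le_log_iff_exp_le (by positivity)]
    exact Real.exp_one_lt_three.le.trans (by exact_mod_cast (by omega : 3 ≤ n))
  have hn1 : (1 : ℝ) ≤ n := by exact_mod_cast (by omega : 1 ≤ n)
  have hn4 : (n : ℝ) ≤ (n : ℝ) ^ 4 := le_self_pow₀ hn1 (by norm_num)
  have hX : (n : ℝ) ^ 4 ≤ (n : ℝ) ^ 4 * Real.log n := le_mul_of_one_le_right (by positivity) hlog1
  have hA0 : 0 ≤ A := by positivity
  have hll : (localLength d : ℝ) ≤ n := by exact_mod_cast hnl
  -- a failed attempt restarts from an arbitrary pair, so `M` itself enters the bound for each `j`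
  have claim : ∀ j ≤ d, ∀ m, (∀ z ∈ agreeBelow n d j, W z ≤ m) → M ≤ matchConst d j * A + m := by
    intro j
    induction j with
    | zero =>
      intro _ m hm
      have := le_of_agree_empty W hJ m hm z₀
      simp only [matchConst]
      linarith
    | succ j ih =>
      intro hj m hm
      have h1 := ih (by omega) _ (le_of_mem_agreeBelow hn hnd W M hz₀ hI hJ ⟨j, hj⟩ m hm)
      set p : ℝ := (1 / 25) ^ localLength d with hp
      have hp0 : 0 < p := by positivity
      have hpq : 25 ^ localLength d * p = 1 := by
        rw [hp, ← mul_pow]; norm_num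
      have h2 : p * M ≤ (matchConst d j + 1) * A + p * m := by
        have := mul_le_mul_of_nonneg_left (min_le_left m M) hp0.le
        nlinarith
      have h3 : M = 25 ^ localLength d * (p * M) := by rw [← mul_assoc, hpq, one_mul]
      rw [h3]
      calc 25 ^ localLength d * (p * M)
          ≤ 25 ^ localLength d * ((matchConst d j + 1) * A + p * m) := by gcongr
        _ = matchConst d (j + 1) * A + (25 ^ localLength d * p) * m := by
            simp only [matchConst]; ring
        _ = _ := by rw [hpq, one_mul]
  have h := claim d le_rfl 0 fun z hz => (hdiag z (eq_of_mem_agreeBelow hz)).le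
  rw [add_zero] at h
  exact (hz₀ z).trans h

end Coupling

/-! ### The coupling -/

section Conclusion

open Config

theorem lintegral_map_uniformOfFintype {Z K : Type} [Fintype K] [Nonempty K] [MeasurableSpace K]
    [DiscreteMeasurableSpace K] [MeasurableSpace Z] [DiscreteMeasurableSpace Z] (φ : K → Z → Z)
    (W : Z → ℝ) (hW : ∀ z, 0 ≤ W z) (z : Z) :
    ∫⁻ w, ENNReal.ofReal (W w) ∂((PMF.uniformOfFintype K).map fun k => φ k z).toMeasure =
      ENNReal.ofReal (stepMean φ W z) := by
  rw [← PMF.toMeasure_map _ _ Measurable.of_discrete,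
    lintegral_map Measurable.of_discrete Measurable.of_discrete, lintegral_fintype]
  simp only [PMF.toMeasure_apply_singleton _ _ (MeasurableSet.of_discrete),
    PMF.uniformOfFintype_apply]
  rw [← Finset.sum_mul, ← ENNReal.ofReal_sum_of_nonneg fun k _ => hW _, stepMean,
    ENNReal.ofReal_div_of_pos (by exact_mod_cast Fintype.card_pos), ENNReal.ofReal_natCast,
    div_eq_mul_inv]

theorem map_fst_uniformOfFintype (K : Type) [Fintype K] [Nonempty K] :
    (PMF.uniformOfFintype (K × K)).map Prod.fst = PMF.uniformOfFintype K := by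
  classical
  ext a
  have hK : (Fintype.card K : ℝ≥0∞) ≠ 0 := by exact_mod_cast Fintype.card_ne_zero
  simp only [PMF.map_apply, tsum_fintype, Fintype.sum_prod_type, PMF.uniformOfFintype_apply,
    Fintype.card_prod]
  rw [Finset.sum_eq_single a (by intro b _ hb; simp [hb.symm]) (by simp)]
  simp only [if_true, Finset.sum_const, Finset.card_univ, nsmul_eq_mul, Nat.cast_mul]
  rw [ENNReal.mul_inv (Or.inl hK) (Or.inr hK), ← mul_assoc,
    ENNReal.mul_inv_cancel hK (ENNReal.natCast_ne_top _), one_mul]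

theorem map_snd_uniformOfFintype (K : Type) [Fintype K] [Nonempty K] :
    (PMF.uniformOfFintype (K × K)).map Prod.snd = PMF.uniformOfFintype K := by
  classical
  ext a
  have hK : (Fintype.card K : ℝ≥0∞) ≠ 0 := by exact_mod_cast Fintype.card_ne_zero
  simp only [PMF.map_apply, tsum_fintype, Fintype.sum_prod_type_right, PMF.uniformOfFintype_apply,
    Fintype.card_prod]
  rw [Finset.sum_eq_single a (by intro b _ hb; simp [hb.symm]) (by simp)]
  simp only [if_true, Finset.sum_const, Finset.card_univ, nsmul_eq_mul, Nat.cast_mul]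
  rw [ENNReal.mul_inv (Or.inl hK) (Or.inr hK), ← mul_assoc,
    ENNReal.mul_inv_cancel hK (ENNReal.natCast_ne_top _), one_mul]

variable {n d : ℕ}

open scoped Classical in
/-- The coupling steered by a cost `W`: the copies move identically once they agree, and otherwise
they move identically or independently, whichever has the smaller expected cost after the step. -/
noncomputable def greedyCoupling (W : Config n (Fin d) × Config n (Fin d) → ℝ)
    (z : Config n (Fin d) × Config n (Fin d)) : PMF (Config n (Fin d) × Config n (Fin d)) :=
  if z.1 = z.2 ∨ stepMean (identicalMove n d) W z ≤ stepMean (independentMove n d) W z then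
    (PMF.uniformOfFintype (Fin 5)).map fun k => identicalMove n d k z
  else (PMF.uniformOfFintype (Fin 5 × Fin 5)).map fun k => independentMove n d k z

theorem isMarkovCoupling_greedyCoupling (W : Config n (Fin d) × Config n (Fin d) → ℝ) :
    IsMarkovCoupling step (greedyCoupling W) := by
  intro z
  unfold greedyCoupling
  split_ifs
  · rw [PMF.map_comp, PMF.map_comp]
    exact ⟨rfl, rfl⟩
  · rw [PMF.map_comp, PMF.map_comp]
    unfold step
    rw [← map_fst_uniformOfFintype (Fin 5), PMF.map_comp]
    refine ⟨rfl, ?_⟩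
    rw [map_fst_uniformOfFintype, ← map_snd_uniformOfFintype (Fin 5), PMF.map_comp]
    rfl

theorem coalesces_greedyCoupling (W : Config n (Fin d) × Config n (Fin d) → ℝ) :
    Coalesces (greedyCoupling W) := by
  intro x w hw
  rw [greedyCoupling, if_pos (Or.inl rfl), PMF.support_map] at hw
  obtain ⟨k, -, rfl⟩ := hw
  rfl

theorem lintegral_greedyCoupling [Countable (Config n (Fin d))]
    (W : Config n (Fin d) × Config n (Fin d) → ℝ) (hW : ∀ z, 0 ≤ W z)
    (z : Config n (Fin d) × Config n (Fin d)) (hz : z.1 ≠ z.2) :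
    ∫⁻ w, ENNReal.ofReal (W w) ∂(greedyCoupling W z).toMeasure =
      ENNReal.ofReal (min (stepMean (identicalMove n d) W z)
        (stepMean (independentMove n d) W z)) := by
  unfold greedyCoupling
  split_ifs with h
  · rw [lintegral_map_uniformOfFintype _ W hW, min_eq_left (h.resolve_left hz)]
  · rw [lintegral_map_uniformOfFintype _ W hW, min_eq_right (not_le.1 fun h' => h (Or.inr h')).le]

theorem stepMean_nonneg {Z K : Type} [Fintype K] (φ : K → Z → Z) {W : Z → ℝ} (hW : ∀ z, 0 ≤ W z)
    (z : Z) : 0 ≤ stepMean φ W z :=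
  div_nonneg (Finset.sum_nonneg fun _ _ => hW _) (by positivity)

end Conclusion

theorem theorem4 (d : ℕ) :
    ∃ C : ℝ, ∀ᶠ n : ℕ in atTop,
      ∃ Q : Config n (Fin d) × Config n (Fin d) → PMF (Config n (Fin d) × Config n (Fin d)),
        IsMarkovCoupling Config.step Q ∧ Coalesces Q ∧
          ∀ (x : Config n (Fin d)) (π : PMF (Config n (Fin d))),
            IsStationaryDist Config.step π →
              expectedMeetingTime Q x π ≤ ENNReal.ofReal (C * (n : ℝ) ^ 4 * Real.log n) := by
  refine ⟨matchConst d d * 300000, ?_⟩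
  filter_upwards [eventually_ge_atTop (9 + d + localLength d)] with n hn
  have : NeZero n := ⟨by omega⟩
  obtain ⟨W, W0, WA, WT, WP⟩ := exists_expected_hitting
    {z : Config n (Fin d) × Config n (Fin d) | z.1 = z.2}
    (fun W z => min (stepMean (identicalMove n d) W z) (stepMean (independentMove n d) W z))
    (fun f g h z => min_le_min (stepMean_mono _ h z) (stepMean_mono _ h z))
    (continuous_pi fun z => ((continuous_apply z).comp (continuous_stepMean _)).min
      ((continuous_apply z).comp (continuous_stepMean _)))
    (fun z => by simp [stepMean_zero])
    (matchConst d d * (300000 * (n : ℝ) ^ 4 * Real.log n))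
    (fun h h0 hT hP => by
      have hI : ∀ z, h z ≤ 1 + stepMean (identicalMove n d) h z := fun z => by
        by_cases hz : z.1 = z.2
        · rw [hT z hz]; linarith [stepMean_nonneg (identicalMove n d) h0 z]
        · exact (hP z hz).trans (by gcongr; exact min_le_left _ _)
      have hJ : ∀ z, h z ≤ 1 + stepMean (independentMove n d) h z := fun z => by
        by_cases hz : z.1 = z.2
        · rw [hT z hz]; linarith [stepMean_nonneg (independentMove n d) h0 z]
        · exact (hP z hz).trans (by gcongr; exact min_le_right _ _)
      exact le_of_subsolution (by omega) (by omega) (by omega) h hT hI hJ)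
  refine ⟨greedyCoupling W, isMarkovCoupling_greedyCoupling W, coalesces_greedyCoupling W,
    fun x π _ => ?_⟩
  refine expectedMeetingTime_le _ (coalesces_greedyCoupling W) (fun z => ENNReal.ofReal (W z)) _
    (fun z => ENNReal.ofReal_le_ofReal ?_) (fun x => by rw [WT (x, x) rfl, ENNReal.ofReal_zero])
    (fun z hz => ?_) x π
  · refine (WA z).trans_eq (by ring)
  · rw [lintegral_greedyCoupling W W0 z hz, WP z hz, ENNReal.ofReal_add zero_le_one
      (le_min (stepMean_nonneg _ W0 z) (stepMean_nonneg _ W0 z)), ENNReal.ofReal_one]
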